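/- A numerical semigroup is a subset $\Lambda\subseteq\mathbb N_0$ that contains $0$, is closed under addition and has finite complement; its genus is $g(\Lambda)=\#(\mathbb N_0\setminus\Lambda)$, and its Frobenius number is $c(\Lambda)-1$, where $c(\Lambda)=\min\{c\in\mathbb N_0: c+\mathbb N_0\subseteq\Lambda\}$. Theorem. For each integer $f\ge 1$, let $\Lambda_f$ be a numerical semigroup chosen uniformly at random from the (finite, nonempty) set of numerical semigroups with Frobenius number $f$. Then, as $f\to\infty$, \[\frac{1}{\sqrt f}\left(g(\Lambda_f)-\frac{3f}{4}\right)\] converges in distribution to the normal law $\mathcal N(0,\tfrac18)$ with mean $0$ and variance $\tfrac18$; equivalently, $\sqrt{8/f}\,\bigl(g(\Lambda_f)-3f/4\bigr)$ converges in distribution to the standard normal law. -/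

import Mathlib

open MeasureTheory ProbabilityTheory Filter
open scoped NNReal

/-- A numerical semigroup: a subset of `ℕ = {0, 1, 2, …}` that contains `0`, is closed under
addition and has finite complement. -/
@[ext]
structure NumericalSemigroup where
  toAddSubmonoid : AddSubmonoid ℕ
  finite_compl : ((toAddSubmonoid : Set ℕ)ᶜ).Finite

namespace NumericalSemigroup

instance : SetLike NumericalSemigroup ℕ where
  coe S := S.toAddSubmonoid
  coe_injective _ _ h := NumericalSemigroup.ext (SetLike.coe_injective h)

/-- The genus: the number of gaps, i.e. of elements of `ℕ ∖ Λ`. -/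
noncomputable def genus (S : NumericalSemigroup) : ℕ := ((S : Set ℕ)ᶜ).ncard

/-- The conductor: the least `c` such that `c + ℕ ⊆ Λ`. -/
noncomputable def conductor (S : NumericalSemigroup) : ℕ := sInf {c : ℕ | ∀ n : ℕ, c + n ∈ S}

/-- The Frobenius number: the conductor minus one (it is `-1` for `Λ = ℕ`). -/
noncomputable def frobenius (S : NumericalSemigroup) : ℤ := (S.conductor : ℤ) - 1

/-- The set of all numerical semigroups with Frobenius number `f`. -/
def withFrobenius (f : ℤ) : Set NumericalSemigroup := {S | S.frobenius = f}

theorem conductor_spec (S : NumericalSemigroup) (n : ℕ) : S.conductor + n ∈ S := by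
  have h : {c : ℕ | ∀ n : ℕ, c + n ∈ S}.Nonempty := by
    obtain ⟨b, hb⟩ := S.finite_compl.bddAbove
    refine ⟨b + 1, fun n => ?_⟩
    by_contra hn
    have : b + 1 + n ≤ b := hb hn
    omega
  exact Nat.sInf_mem h n

/-- For `f ≥ 0`, the Frobenius number is `f` exactly when `f` is the largest gap. -/
theorem frobenius_eq_iff (S : NumericalSemigroup) (f : ℕ) :
    S.frobenius = f ↔ IsGreatest ((S : Set ℕ)ᶜ) f := by
  constructor
  · intro h
    have hc : S.conductor = f + 1 := by unfold frobenius at h; omega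
    have hmem : ∀ k, f < k → k ∈ S := by
      intro k hk
      have := S.conductor_spec (k - (f + 1))
      rw [hc] at this
      rwa [show f + 1 + (k - (f + 1)) = k by omega] at this
    refine ⟨fun hf => ?_, fun k hk => ?_⟩
    · have : S.conductor ≤ f := Nat.sInf_le fun n => by
        rcases Nat.eq_zero_or_pos n with rfl | hn
        · exact hf
        · exact hmem _ (by omega)
      omega
    · by_contra hk'
      exact hk (hmem k (by omega))
  · rintro ⟨hf, hub⟩
    have h1 : S.conductor ≤ f + 1 := Nat.sInf_le fun n => by
      by_contra hn
      have : f + 1 + n ≤ f := hub hn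
      omega
    have h2 : f < S.conductor := by
      by_contra hlt
      have := S.conductor_spec (f - S.conductor)
      rw [show S.conductor + (f - S.conductor) = f by omega] at this
      exact hf this
    unfold frobenius
    omega

theorem withFrobenius_finite (f : ℕ) : (withFrobenius f).Finite := by
  refine Set.Finite.of_finite_image (f := fun S : NumericalSemigroup => ((S : Set ℕ)ᶜ))
    ((Set.finite_Iic f).finite_subsets.subset ?_) ?_
  · rintro _ ⟨S, hS, rfl⟩ k hk
    exact ((S.frobenius_eq_iff f).1 hS).2 hk
  · intro S _ T _ h
    exact SetLike.coe_injective (compl_injective h)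

theorem withFrobenius_nonempty (f : ℕ) (hf : 0 < f) : (withFrobenius f).Nonempty := by
  let M : AddSubmonoid ℕ :=
    { carrier := {n | n = 0 ∨ f < n}
      zero_mem' := Or.inl rfl
      add_mem' := by
        intro a b ha hb
        simp only [Set.mem_ofPred_eq] at ha hb ⊢
        omega }
  have hM : ∀ n, n ∈ M ↔ n = 0 ∨ f < n := fun n => Iff.rfl
  have hfin : ((M : Set ℕ)ᶜ).Finite := by
    refine (Set.finite_Iic f).subset fun n hn => ?_
    by_contra h
    exact hn (Or.inr (not_le.1 h))
  refine ⟨⟨M, hfin⟩, (frobenius_eq_iff _ f).2 ⟨fun h => ?_, fun n hn => ?_⟩⟩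
  · rcases (hM f).1 h with h | h <;> omega
  · by_contra h
    exact hn (Or.inr (not_le.1 h))

instance : MeasurableSpace NumericalSemigroup := ⊤

instance : DiscreteMeasurableSpace NumericalSemigroup := ⟨fun _ => trivial⟩

/-- The law of a uniformly random numerical semigroup with Frobenius number `f ≥ 1`. -/
noncomputable def uniformLaw (f : ℕ+) : Measure NumericalSemigroup :=
  uniformOn (withFrobenius ((f : ℕ) : ℤ))

instance (f : ℕ+) : IsProbabilityMeasure (uniformLaw f) :=
  isProbabilityMeasure_uniformOn (withFrobenius_finite f) (withFrobenius_nonempty f f.pos)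

end NumericalSemigroup

/-! A semigroup with Frobenius number `f` is encoded by its trace `T` on `(0, f)`, and its genus is
`f - #T` (`genus_add_card_trace`). The theorem holds because `#T` is, up to a negligible error, the
number of heads in about `f/2` independent fair coin tosses: mean `f/4`, variance `f/8`.

Write `n = (f - 1) / 2`. Every subset of the upper half of `(0, f)` is a trace, so there are at
least `2 ^ n` of them. Traces whose least element `m` lies well below `f/2` are rare. For `m < f/4`,
pairing residue classes modulo `m` bounds their number by `15 ^ (f/8)`, and `15 ^ (1/8) < √2`
(`card_tracesWithMin_pow_le`). For `f/4 < m < f/2`, closure under adding `m` and the elements forced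
by the lower half give `2 ^ n * (35/36) ^ (n - m)` (`card_tracesWithMin_le`). Hence all but a small
proportion of traces are good: their elements are at least `n - K`.

A good trace is a core of at most `4K + 5` elements together with an arbitrary subset of a window of
`w = n - 3K - 3` elements, chosen independently (`sum_goodTraces_pow_card`). At frequency `s = t /
√f` the window contributes `cos (s/2) ^ w` to the characteristic function, and the core with the
centring costs at most `|s| (4K + 5)`. With `K` of order `f ^ (1/4)` all errors vanish and the limit
is `exp (-t²/16)`; Lévy's continuity theorem concludes. -/

namespace NumericalSemigroup

open scoped Topology Pointwise

/-! ### Traces, and counting families of sets block by block -/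

open Finset in
/-- The traces on `(0, f)` of the numerical semigroups with Frobenius number `f`. -/
def traces (f : ℕ) : Finset (Finset ℕ) :=
  {T ∈ (Ioo 0 f).powerset | ∀ x ∈ T, ∀ y ∈ T, x + y ≠ f ∧ (x + y < f → x + y ∈ T)}

open Finset in
/-- The traces with least element `m`. -/
def tracesWithMin (f m : ℕ) : Finset (Finset ℕ) :=
  {T ∈ traces f | m ∈ T ∧ ∀ x ∈ T, m ≤ x}

theorem mem_traces {f : ℕ} {T : Finset ℕ} :
    T ∈ traces f ↔ (∀ x ∈ T, 0 < x ∧ x < f) ∧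
      ∀ x ∈ T, ∀ y ∈ T, x + y ≠ f ∧ (x + y < f → x + y ∈ T) := by
  simp [traces, Finset.subset_iff]

theorem mem_tracesWithMin {f m : ℕ} {T : Finset ℕ} :
    T ∈ tracesWithMin f m ↔ T ∈ traces f ∧ m ∈ T ∧ ∀ x ∈ T, m ≤ x := by
  simp [tracesWithMin]

/-- A family of sets whose members are determined by their traces on the blocks `β i` is at most
as large as the product of the numbers of traces on the blocks. -/
theorem card_le_prod_card_image_inter {α ι : Type*} [DecidableEq α] [DecidableEq ι]
    (𝓕 : Finset (Finset α)) (I : Finset ι) (β : ι → Finset α)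
    (h : ∀ T ∈ 𝓕, ∀ T' ∈ 𝓕, (∀ i ∈ I, T ∩ β i = T' ∩ β i) → T = T') :
    𝓕.card ≤ ∏ i ∈ I, (𝓕.image (· ∩ β i)).card := by
  rw [← Finset.card_pi]
  refine Finset.card_le_card_of_injOn (fun T i _ => T ∩ β i) ?_ ?_
  · intro T hT
    rw [Finset.mem_coe, Finset.mem_pi]
    exact fun i _ => Finset.mem_image_of_mem _ hT
  · intro T hT T' hT' hTT'
    exact h T hT T' hT' fun i hi => congrFun (congrFun hTT' i) hi

/-! ### Least element below `f/4`: residue classes modulo `m` -/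

theorem two_mul_card_add_le (t : ℕ) :
    2 * ((Finset.range (t + 1) ×ˢ Finset.range (t + 1)).filter fun p => p.1 + p.2 ≤ t).card
      = (t + 1) * (t + 2) := by
  have h : ((Finset.range (t + 1) ×ˢ Finset.range (t + 1)).filter fun p => p.1 + p.2 ≤ t)
      = (Finset.range (t + 1)).biUnion fun s => Finset.HasAntidiagonal.antidiagonal s := by
    ext ⟨a, b⟩
    simp only [Finset.mem_filter, Finset.mem_product, Finset.mem_range, Finset.mem_biUnion,
      Finset.HasAntidiagonal.mem_antidiagonal]
    constructor
    · rintro ⟨_, h⟩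
      exact ⟨a + b, by omega, rfl⟩
    · rintro ⟨s, hs, h⟩
      omega
  rw [h, Finset.card_biUnion]
  · clear h
    simp only [Finset.Nat.card_antidiagonal]
    induction t with
    | zero => simp
    | succ t ih =>
      rw [Finset.sum_range_succ, mul_add, ih]
      ring
  · intro s _ s' _ hss'
    rw [Function.onFun, Finset.disjoint_left]
    intro p hp hp'
    rw [Finset.HasAntidiagonal.mem_antidiagonal] at hp hp'
    omega

/-- Equality holds at `t = 4`, where the triangular number is `15`. A pair of classes of size `t`
will cost `15 ^ (t/4)`, that is `15 ^ (1/8) < √2` per element. Size `t = 3` would cost `10 ^ (1/6) >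
√2`, whence the restriction to `m < f/4`. -/
theorem triangle_pow_four_le (t : ℕ) (ht : 4 ≤ t) :
    ((t + 1) * (t + 2)) ^ 4 ≤ 2 ^ 4 * 15 ^ t := by
  induction t, ht using Nat.le_induction with
  | base => norm_num
  | succ t ht ih =>
    have h1 : (5 * ((t + 1 + 1) * (t + 1 + 2))) ^ 4 ≤ (7 * ((t + 1) * (t + 2))) ^ 4 := by
      apply Nat.pow_le_pow_left
      nlinarith
    rw [mul_pow 5, mul_pow 7] at h1
    rw [pow_succ 15]
    omega

/-- The residue class of `i` modulo `m` in `(0, f)`. -/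
def residueClass (f m i : ℕ) : Finset ℕ := {x ∈ Finset.Ioo 0 f | x ≡ i [MOD m]}

theorem mem_residueClass {f m i x : ℕ} :
    x ∈ residueClass f m i ↔ (0 < x ∧ x < f) ∧ x ≡ i [MOD m] := by
  simp [residueClass]

theorem add_mul_mem {f m : ℕ} {T : Finset ℕ} (hT : T ∈ tracesWithMin f m) {x : ℕ} (hx : x ∈ T)
    (k : ℕ) : x + k * m ≠ f ∧ (x + k * m < f → x + k * m ∈ T) := by
  obtain ⟨hT, hm, -⟩ := mem_tracesWithMin.1 hT
  obtain ⟨hT0, hT⟩ := mem_traces.1 hT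
  induction k with
  | zero => simpa using ⟨(hT0 x hx).2.ne, fun _ => hx⟩
  | succ k ih =>
    have hm0 := (hT0 m hm).1
    rw [show x + (k + 1) * m = x + k * m + m by ring]
    by_cases h : x + k * m < f
    · exact hT _ (ih.2 h) _ hm
    · have := ih.1
      omega

theorem mem_of_modEq_of_le {f m : ℕ} {T : Finset ℕ} (hT : T ∈ tracesWithMin f m) {x y : ℕ}
    (hx : x ∈ T) (hxy : x ≤ y) (hy : y < f) (h : x ≡ y [MOD m]) : y ∈ T := by
  obtain ⟨k, hk⟩ := (Nat.modEq_iff_dvd' hxy).1 h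
  have hyk : y = x + k * m := by rw [mul_comm k, ← hk]; omega
  rw [hyk] at hy ⊢
  exact (add_mul_mem hT hx k).2 hy

/-- Closure under adding `m` makes the part of a trace in a residue class a final segment of that
class. Final segments are nested, so size determines them. -/
theorem inter_residueClass_eq_of_card_eq {f m i : ℕ} {T T' : Finset ℕ}
    (hT : T ∈ tracesWithMin f m) (hT' : T' ∈ tracesWithMin f m)
    (h : (T ∩ residueClass f m i).card = (T' ∩ residueClass f m i).card) :
    T ∩ residueClass f m i = T' ∩ residueClass f m i := by
  by_cases hsub : T ∩ residueClass f m i ⊆ T' ∩ residueClass f m i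
  · exact Finset.eq_of_subset_of_card_le hsub h.ge
  · refine (Finset.eq_of_subset_of_card_le ?_ h.le).symm
    obtain ⟨x, hx, hx'⟩ := Finset.not_subset.1 hsub
    intro y hy
    simp only [Finset.mem_inter, mem_residueClass] at hx hx' hy ⊢
    refine ⟨?_, hy.2⟩
    have hxy : x ≡ y [MOD m] := hx.2.2.trans hy.2.2.symm
    rcases le_total x y with hle | hle
    · exact mem_of_modEq_of_le hT hx.1 hle hy.2.1.2 hxy
    · exact absurd ⟨mem_of_modEq_of_le hT' hy.1 hle hx.2.1.2 hxy.symm, hx.2⟩ hx'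

/-- The reflection `x ↦ f - x` carries the class of `f - i` into that of `i`, and sends elements of
`T` outside `T`. -/
theorem card_inter_residueClass_add_le {f m i : ℕ} {T : Finset ℕ}
    (hT : T ∈ tracesWithMin f m) (hi : i ≤ f) :
    (T ∩ residueClass f m i).card + (T ∩ residueClass f m (f - i)).card
      ≤ (residueClass f m i).card := by
  obtain ⟨hT0, hTs⟩ := mem_traces.1 (mem_tracesWithMin.1 hT).1
  have hinj : Set.InjOn (fun x => f - x) (T ∩ residueClass f m (f - i) : Finset ℕ) := by
    intro x hx y hy hxy
    have hx := hT0 x (Finset.mem_inter.1 hx).1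
    have hy := hT0 y (Finset.mem_inter.1 hy).1
    simp only at hxy
    omega
  rw [← Finset.card_image_of_injOn hinj, ← Finset.card_union_of_disjoint]
  · refine Finset.card_le_card (Finset.union_subset Finset.inter_subset_right ?_)
    intro y hy
    obtain ⟨x, hx, rfl⟩ := Finset.mem_image.1 hy
    simp only [Finset.mem_inter, mem_residueClass] at hx ⊢
    refine ⟨by omega, ?_⟩
    have h1 : x + (f - x) ≡ (f - i) + i [MOD m] := by
      rw [show x + (f - x) = f by omega, show f - i + i = f by omega]
    exact Nat.ModEq.add_left_cancel hx.2.2 h1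
  · rw [Finset.disjoint_left]
    intro y hy hy'
    obtain ⟨x, hx, rfl⟩ := Finset.mem_image.1 hy'
    have hx := (Finset.mem_inter.1 hx).1
    have := hT0 x hx
    exact (hTs x hx _ (Finset.mem_inter.1 hy).1).1 (by omega)

theorem card_image_inter_residueClass_le (f m i t : ℕ) (hi : i ≤ f)
    (ht : (residueClass f m i).card ≤ t) :
    2 * ((tracesWithMin f m).image
      (· ∩ (residueClass f m i ∪ residueClass f m (f - i)))).card ≤ (t + 1) * (t + 2) := by
  rw [← two_mul_card_add_le]
  refine Nat.mul_le_mul_left 2 (Finset.card_le_card_of_injOn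
    (fun Z => ((Z ∩ residueClass f m i).card, (Z ∩ residueClass f m (f - i)).card)) ?_ ?_)
  · intro Z hZ
    obtain ⟨T, hT, rfl⟩ := Finset.mem_image.1 hZ
    have := card_inter_residueClass_add_le hT hi
    simp only [Finset.inter_assoc, Finset.union_inter_cancel_left,
      Finset.union_inter_cancel_right, Finset.coe_filter, Finset.mem_product, Finset.mem_range,
      Set.mem_ofPred_eq]
    omega
  · intro Z hZ Z' hZ' h
    obtain ⟨T, hT, rfl⟩ := Finset.mem_image.1 hZ
    obtain ⟨T', hT', rfl⟩ := Finset.mem_image.1 hZ'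
    simp only [Finset.inter_assoc, Finset.union_inter_cancel_left,
      Finset.union_inter_cancel_right, Prod.mk.injEq] at h
    simp only [Finset.inter_union_distrib_left]
    rw [inter_residueClass_eq_of_card_eq hT hT' h.1, inter_residueClass_eq_of_card_eq hT hT' h.2]

/-- The value `f` at `i = r` is a placeholder: a trace containing `m` misses the class of `f`, so
that class is never counted. -/
theorem card_residueClass_le (f m i q r : ℕ) (hr : r < m) (hi : i < m)
    (hf : f = q * m + r) :
    (residueClass f m i).card ≤ if i < r then q + 1 else if r < i then q else f := by
  have hmod : ∀ x ∈ residueClass f m i, x = m * (x / m) + i := by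
    intro x hx
    have h := (mem_residueClass.1 hx).2
    rw [Nat.ModEq, Nat.mod_eq_of_lt hi] at h
    have := Nat.div_add_mod x m
    omega
  have hinj : Set.InjOn (fun x => x / m) (residueClass f m i : Set ℕ) := by
    intro x hx y hy hxy
    rw [hmod x hx, hmod y hy]
    simp only at hxy
    rw [hxy]
  have key : ∀ k, (∀ x ∈ residueClass f m i, x / m < k) → (residueClass f m i).card ≤ k := by
    intro k hk
    have := Finset.card_le_card_of_injOn (t := Finset.range k) (fun x => x / m)
      (fun x hx => by simpa using hk x hx) hinj
    simpa using this
  split_ifs with h1 h2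
  · refine key _ fun x hx => ?_
    have h := (mem_residueClass.1 hx).1
    rw [Nat.div_lt_iff_lt_mul (by omega), add_mul]
    omega
  · refine key _ fun x hx => ?_
    have h := (mem_residueClass.1 hx).1
    have hx' := hmod x hx
    by_contra hc
    have : m * q ≤ m * (x / m) := Nat.mul_le_mul_left m (by omega)
    rw [mul_comm q] at hf
    omega
  · refine key _ fun x hx => ?_
    have h := (mem_residueClass.1 hx).1
    exact (Nat.div_le_self _ _).trans_lt h.2

theorem card_tracesWithMin_pow_le (f m : ℕ) (hm : 4 * m < f) :
    (tracesWithMin f m).card ^ 8 ≤ 15 ^ f := by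
  rcases Nat.eq_zero_or_pos m with rfl | hm0
  · have : tracesWithMin f 0 = ∅ := by
      refine Finset.eq_empty_of_forall_notMem fun T hT => ?_
      obtain ⟨hT, h0, -⟩ := mem_tracesWithMin.1 hT
      exact absurd ((mem_traces.1 hT).1 0 h0).1 (lt_irrefl 0)
    simp [this]
  obtain ⟨q, r, hr, hf⟩ : ∃ q r, r < m ∧ f = q * m + r :=
    ⟨f / m, f % m, Nat.mod_lt _ hm0, by rw [mul_comm, Nat.div_add_mod]⟩
  have hq : 4 ≤ q := by
    by_contra hc
    have : q * m ≤ 3 * m := Nat.mul_le_mul_right m (by omega)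
    omega
  have hmf : m ≤ f := by omega
  set 𝓕 := tracesWithMin f m with h𝓕
  set β : ℕ → Finset ℕ := fun i => residueClass f m i ∪ residueClass f m (f - i) with hβ
  have hzero : ∀ T ∈ 𝓕, ∀ x, 0 < x → x < f → x ≡ 0 [MOD m] → x ∈ T := by
    intro T hT x hx0 hxf hx
    have hmT := (mem_tracesWithMin.1 hT).2.1
    have hdvd : m ∣ x := (Nat.modEq_zero_iff_dvd).1 hx
    refine mem_of_modEq_of_le hT hmT (Nat.le_of_dvd hx0 hdvd) hxf ?_
    exact ((Nat.modEq_zero_iff_dvd).2 dvd_rfl).trans hx.symm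
  have hrr : ∀ T ∈ 𝓕, ∀ x ∈ T, ¬ x ≡ r [MOD m] := by
    intro T hT x hx hxr
    have hxf := ((mem_traces.1 (mem_tracesWithMin.1 hT).1).1 x hx).2
    have h1 : x ≡ f [MOD m] := hxr.trans (by rw [hf]; simp [Nat.ModEq])
    obtain ⟨k, hk⟩ := (Nat.modEq_iff_dvd' hxf.le).1 h1
    refine (add_mul_mem hT hx k).1 ?_
    rw [mul_comm]
    omega
  have hfi : ∀ i j, i + j ≡ f [MOD m] → i ≤ f → j ≡ f - i [MOD m] := by
    intro i j hij hi
    refine Nat.ModEq.add_left_cancel (Nat.ModEq.refl i) ?_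
    rwa [show i + (f - i) = f by omega]
  -- The class `0` lies in every trace and the class `r` in none. The other residues are paired by
  -- `i ↔ r - i` below `r` and `i ↔ m + r - i` above `r`; one index per pair suffices, a self-paired
  -- residue being its own block.
  have hsub : ∀ T ∈ 𝓕, ∀ T' ∈ 𝓕,
      (∀ i ∈ Finset.Icc 1 (r / 2) ∪ Finset.Ioc r ((m + r) / 2), T ∩ β i = T' ∩ β i) → T ⊆ T' := by
    intro T hT T' hT' h x hx
    obtain ⟨hx0, hxf⟩ := (mem_traces.1 (mem_tracesWithMin.1 hT).1).1 x hx
    have hxm := Nat.mod_lt x hm0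
    have hxx : x ≡ x % m [MOD m] := (Nat.mod_modEq x m).symm
    have key : ∀ i ∈ Finset.Icc 1 (r / 2) ∪ Finset.Ioc r ((m + r) / 2),
        x ∈ β i → x ∈ T' := by
      intro i hi hxi
      have : x ∈ T ∩ β i := Finset.mem_inter.2 ⟨hx, hxi⟩
      rw [h i hi] at this
      exact (Finset.mem_inter.1 this).1
    simp only [Finset.mem_union, Finset.mem_Icc, Finset.mem_Ioc, hβ, mem_residueClass] at key
    have hfr : f ≡ r [MOD m] := by rw [hf]; simp [Nat.ModEq]
    by_cases h0 : x % m = 0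
    · exact hzero T' hT' x hx0 hxf (h0 ▸ hxx)
    by_cases h1 : x % m = r
    · exact absurd (h1 ▸ hxx) (hrr T hT x hx)
    by_cases h2 : x % m < r
    · by_cases h3 : x % m ≤ r / 2
      · exact key (x % m) (by omega) (Or.inl ⟨⟨hx0, hxf⟩, hxx⟩)
      · refine key (r - x % m) (by omega) (Or.inr ⟨⟨hx0, hxf⟩, hfi _ _ ?_ (by omega)⟩)
        refine (Nat.ModEq.add_left _ hxx).trans ?_
        rw [show r - x % m + x % m = r by omega]
        exact hfr.symm
    · by_cases h3 : x % m ≤ (m + r) / 2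
      · exact key (x % m) (by omega) (Or.inl ⟨⟨hx0, hxf⟩, hxx⟩)
      · refine key (m + r - x % m) (by omega) (Or.inr ⟨⟨hx0, hxf⟩, hfi _ _ ?_ (by omega)⟩)
        refine (Nat.ModEq.add_left _ hxx).trans ?_
        rw [show m + r - x % m + x % m = m + r by omega]
        refine Nat.ModEq.trans ?_ hfr.symm
        simp [Nat.ModEq]
  have hcard := card_le_prod_card_image_inter 𝓕
    (Finset.Icc 1 (r / 2) ∪ Finset.Ioc r ((m + r) / 2)) β
    (fun T hT T' hT' h => (hsub T hT T' hT' h).antisymm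
      (hsub T' hT' T hT fun i hi => (h i hi).symm))
  rw [Finset.prod_union (by
    rw [Finset.disjoint_left]
    intro x hx hx'
    rw [Finset.mem_Icc] at hx
    rw [Finset.mem_Ioc] at hx'
    omega)] at hcard
  have hpow : ∀ i t, i ≤ f → 4 ≤ t → (residueClass f m i).card ≤ t →
      ((𝓕.image (· ∩ β i)).card) ^ 4 ≤ 15 ^ t := by
    intro i t hi ht hct
    have h1 := Nat.pow_le_pow_left (card_image_inter_residueClass_le f m i t hi hct) 4
    rw [mul_pow] at h1
    exact Nat.le_of_mul_le_mul_left (h1.trans (triangle_pow_four_le t ht)) (by norm_num)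
  have hp1 : (∏ i ∈ Finset.Icc 1 (r / 2), (𝓕.image (· ∩ β i)).card) ^ 4
      ≤ (15 ^ (q + 1)) ^ (r / 2) := by
    rw [← Finset.prod_pow]
    refine (Finset.prod_le_pow_card _ _ (15 ^ (q + 1)) fun i hi => ?_).trans (by simp)
    rw [Finset.mem_Icc] at hi
    refine hpow i (q + 1) (by omega) (by omega) ?_
    have := card_residueClass_le f m i q r hr (by omega) hf
    rwa [if_pos (by omega)] at this
  have hp2 : (∏ i ∈ Finset.Ioc r ((m + r) / 2), (𝓕.image (· ∩ β i)).card) ^ 4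
      ≤ (15 ^ q) ^ ((m - r) / 2) := by
    rw [← Finset.prod_pow]
    refine (Finset.prod_le_pow_card _ _ (15 ^ q) fun i hi => ?_).trans ?_
    · rw [Finset.mem_Ioc] at hi
      refine hpow i q (by omega) (by omega) ?_
      have := card_residueClass_le f m i q r hr (by omega) hf
      rwa [if_neg (by omega), if_pos (by omega)] at this
    · rw [Nat.card_Ioc, show (m + r) / 2 - r = (m - r) / 2 by omega]
  calc 𝓕.card ^ 8 ≤ (_ * _) ^ 8 := Nat.pow_le_pow_left hcard 8
    _ = (_ ^ 4 * _ ^ 4) ^ 2 := by ring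
    _ ≤ ((15 ^ (q + 1)) ^ (r / 2) * (15 ^ q) ^ ((m - r) / 2)) ^ 2 :=
      Nat.pow_le_pow_left (Nat.mul_le_mul hp1 hp2) 2
    _ = 15 ^ ((q + 1) * (2 * (r / 2)) + q * (2 * ((m - r) / 2))) := by
      rw [← pow_mul, ← pow_mul, ← pow_add, ← pow_mul]
      congr 1
      ring
    _ ≤ 15 ^ f := by
      refine Nat.pow_le_pow_right (by norm_num) ?_
      calc _ ≤ (q + 1) * r + q * (m - r) :=
            Nat.add_le_add (Nat.mul_le_mul_left _ (by omega)) (Nat.mul_le_mul_left _ (by omega))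
        _ = f := by
            obtain ⟨d, rfl⟩ := Nat.exists_eq_add_of_lt hr
            rw [hf, show r + d + 1 - r = d + 1 by omega]
            ring

/-! ### Least element between `f/4` and `f/2` -/

/-- Bound for a family of sets that are determined by their traces on `U`, are closed under the
translation `b ↦ b + m` for `b ∈ B`, and all agree on `F`: each pair `{b, b + m}` costs a factor
`3 / 4` and each element of `F` a factor `2 / 3`. -/
theorem card_le_of_translate_closed (𝓕 : Finset (Finset ℕ)) (U B F : Finset ℕ) (m : ℕ)
    (hBU : B ⊆ U) (hBmU : B.image (· + m) ⊆ U) (hdisj : Disjoint B (B.image (· + m)))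
    (hdet : ∀ T ∈ 𝓕, ∀ T' ∈ 𝓕, T ∩ U = T' ∩ U → T = T')
    (hcl : ∀ T ∈ 𝓕, ∀ b ∈ B, b ∈ T → b + m ∈ T)
    (hFU : F ⊆ U) (hF : ∀ x ∈ F, ∀ T ∈ 𝓕, ∀ T' ∈ 𝓕, x ∈ T → x ∈ T') :
    (𝓕.card : ℝ) ≤ 2 ^ U.card * (3 / 4) ^ B.card * (2 / 3) ^ F.card := by
  set R := U \ (B ∪ B.image (· + m)) with hR
  have hRB : Disjoint R B := by
    rw [hR, Finset.disjoint_left]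
    intro x hx
    simp only [Finset.mem_sdiff, Finset.mem_union] at hx
    tauto
  set β : ℕ → Finset ℕ := fun x => if x ∈ B then {x, x + m} else {x} with hβ
  have h1 := card_le_prod_card_image_inter 𝓕 (R ∪ B) β (by
    intro T hT T' hT' h
    refine hdet T hT T' hT' ?_
    ext x
    simp only [Finset.mem_inter, and_congr_left_iff]
    intro hxU
    have key : ∀ y ∈ R ∪ B, x ∈ β y → (x ∈ T ↔ x ∈ T') := by
      intro y hy hxy
      have := Finset.ext_iff.1 (h y hy) x
      simpa [hxy] using this
    by_cases hxB : x ∈ B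
    · exact key x (Finset.mem_union_right _ hxB) (by simp [hβ, hxB])
    by_cases hxm : x ∈ B.image (· + m)
    · obtain ⟨b, hb, rfl⟩ := Finset.mem_image.1 hxm
      exact key b (Finset.mem_union_right _ hb) (by simp [hβ, hb])
    · refine key x (Finset.mem_union_left _ ?_) (by simp [hβ, hxB])
      simp only [hR, Finset.mem_sdiff, Finset.mem_union]
      tauto)
  rw [Finset.prod_union hRB] at h1
  -- The weight `2/3` is dictated by a pair with one frozen element: two of its three patterns
  -- survive. It is generous in the other cases, where a single pattern is left against `2 * (2/3)`
  -- or `3 * (2/3) ^ 2`.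
  let w : ℕ → ℝ := fun x => if x ∈ F then 2 / 3 else 1
  have hsingle : ∀ x ∈ R, ((𝓕.image (· ∩ β x)).card : ℝ) ≤ 2 * w x := by
    intro x hx
    have hxB : x ∉ B := Finset.disjoint_left.1 hRB hx
    simp only [hβ, hxB, if_false, w]
    split_ifs with hxF
    · have : (𝓕.image (· ∩ {x})).card ≤ 1 := by
        rw [Finset.card_le_one]
        intro Z hZ Z' hZ'
        obtain ⟨T, hT, rfl⟩ := Finset.mem_image.1 hZ
        obtain ⟨T', hT', rfl⟩ := Finset.mem_image.1 hZ'
        have := hF x hxF T hT T' hT'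
        have := hF x hxF T' hT' T hT
        ext y
        simp only [Finset.mem_inter, Finset.mem_singleton]
        constructor <;> rintro ⟨h, rfl⟩ <;> tauto
      have h' : ((𝓕.image (· ∩ {x})).card : ℝ) ≤ 1 := by exact_mod_cast this
      linarith
    · have : (𝓕.image (· ∩ {x})).card ≤ ({x} : Finset ℕ).powerset.card :=
        Finset.card_le_card fun Z hZ => by
          obtain ⟨T, hT, rfl⟩ := Finset.mem_image.1 hZ
          exact Finset.mem_powerset.2 Finset.inter_subset_right
      rw [Finset.card_powerset, Finset.card_singleton] at this
      have h' : ((𝓕.image (· ∩ {x})).card : ℝ) ≤ 2 := by exact_mod_cast this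
      linarith
  have hpair : ∀ x ∈ B, ((𝓕.image (· ∩ β x)).card : ℝ) ≤ 3 * (w x * w (x + m)) := by
    intro x hx
    simp only [hβ, hx, if_true]
    have hmem : ∀ T ∈ 𝓕, ∀ Z, T ∩ {x, x + m} = Z ↔
        Z ⊆ {x, x + m} ∧ (x ∈ T ↔ x ∈ Z) ∧ (x + m ∈ T ↔ x + m ∈ Z) := by
      intro T hT Z
      constructor
      · rintro rfl
        simp
      · rintro ⟨h, h1, h2⟩
        ext y
        simp only [Finset.mem_inter, Finset.mem_insert, Finset.mem_singleton]
        constructor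
        · rintro ⟨h, rfl | rfl⟩ <;> tauto
        · intro hy
          have := h hy
          simp only [Finset.mem_insert, Finset.mem_singleton] at this
          rcases this with rfl | rfl <;> tauto
    have hsub : ∀ s : Finset (Finset ℕ), (∀ T ∈ 𝓕, T ∩ {x, x + m} ∈ s) →
        ((𝓕.image (· ∩ {x, x + m})).card : ℝ) ≤ s.card := by
      intro s hs
      exact_mod_cast Finset.card_le_card fun Z hZ => by
        obtain ⟨T, hT, rfl⟩ := Finset.mem_image.1 hZ
        exact hs T hT
    have hcases : ∀ T ∈ 𝓕, (x ∉ T ∧ x + m ∉ T ∧ T ∩ {x, x + m} = ∅) ∨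
        (x ∉ T ∧ x + m ∈ T ∧ T ∩ {x, x + m} = {x + m}) ∨
        (x ∈ T ∧ x + m ∈ T ∧ T ∩ {x, x + m} = {x, x + m}) := by
      intro T hT
      have hc := hcl T hT x hx
      by_cases hxT : x ∈ T
      · refine Or.inr (Or.inr ⟨hxT, hc hxT, ?_⟩)
        rw [hmem T hT]
        simp [hxT, hc hxT]
      · by_cases hxmT : x + m ∈ T
        · refine Or.inr (Or.inl ⟨hxT, hxmT, ?_⟩)
          rw [hmem T hT]
          refine ⟨by simp, ?_, by simp [hxmT]⟩
          simp only [hxT, Finset.mem_singleton, false_iff]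
          intro h
          exact hxT (h ▸ hxmT)
        · refine Or.inl ⟨hxT, hxmT, ?_⟩
          rw [hmem T hT]
          simp [hxT, hxmT]
    rcases 𝓕.eq_empty_or_nonempty with h𝓕 | ⟨T₀, hT₀⟩
    · have : 0 ≤ w x * w (x + m) := by
        simp only [w]
        split_ifs <;> norm_num
      simp [h𝓕, this]
    have htwo : ∀ a b : Finset ℕ, ((({a, b} : Finset (Finset ℕ)).card : ℕ) : ℝ) ≤ 2 := by
      intro a b
      exact_mod_cast Finset.card_le_two
    have hthree : ∀ a b c : Finset ℕ,
        ((({a, b, c} : Finset (Finset ℕ)).card : ℕ) : ℝ) ≤ 3 := by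
      intro a b c
      exact_mod_cast Finset.card_le_three
    simp only [w]
    by_cases hxF : x ∈ F <;> by_cases hxmF : x + m ∈ F <;> simp only [hxF, hxmF, if_true, if_false]
    · have := hsub {T₀ ∩ {x, x + m}} fun T hT => by
        rw [Finset.mem_singleton, hmem T hT]
        have := hF x hxF T hT T₀ hT₀
        have := hF x hxF T₀ hT₀ T hT
        have := hF _ hxmF T hT T₀ hT₀
        have := hF _ hxmF T₀ hT₀ T hT
        refine ⟨Finset.inter_subset_right, ?_, ?_⟩ <;> simp <;> tauto
      rw [Finset.card_singleton, Nat.cast_one] at this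
      linarith
    · by_cases hxT₀ : x ∈ T₀
      · have := hsub {{x, x + m}, {x + m}} fun T hT => by
          have := hF x hxF T₀ hT₀ T hT hxT₀
          rcases hcases T hT with h | h | h <;> simp [h.2.2] <;> tauto
        have := htwo {x, x + m} {x + m}
        linarith
      · have := hsub {∅, {x + m}} fun T hT => by
          have := fun h => hxT₀ (hF x hxF T hT T₀ hT₀ h)
          rcases hcases T hT with h | h | h <;> simp [h.2.2] <;> tauto
        have := htwo ∅ {x + m}
        linarith
    · by_cases hxT₀ : x + m ∈ T₀
      · have := hsub {{x, x + m}, {x + m}} fun T hT => by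
          have := hF _ hxmF T₀ hT₀ T hT hxT₀
          rcases hcases T hT with h | h | h <;> simp [h.2.2] <;> tauto
        have := htwo {x, x + m} {x + m}
        linarith
      · have := hsub {∅, {x + m}} fun T hT => by
          have := fun h => hxT₀ (hF _ hxmF T hT T₀ hT₀ h)
          rcases hcases T hT with h | h | h <;> simp [h.2.2] <;> tauto
        have := htwo ∅ {x + m}
        linarith
    · have := hsub {∅, {x + m}, {x, x + m}} fun T hT => by
        rcases hcases T hT with h | h | h <;> simp [h.2.2]
      have := hthree ∅ {x + m} {x, x + m}
      linarith
  have hinj : Set.InjOn (· + m) (B : Set ℕ) := fun _ _ _ _ h => Nat.add_right_cancel h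
  have hUeq : R ∪ (B ∪ B.image (· + m)) = U :=
    Finset.sdiff_union_of_subset (Finset.union_subset hBU hBmU)
  have hdis2 : Disjoint R (B ∪ B.image (· + m)) := Finset.sdiff_disjoint
  have hw : (∏ x ∈ R, w x) * ∏ x ∈ B, (w x * w (x + m)) = (2 / 3) ^ F.card := by
    rw [Finset.prod_mul_distrib, ← Finset.prod_image (f := w) hinj, ← Finset.prod_union hdisj,
      ← Finset.prod_union hdis2, hUeq]
    simp only [w]
    rw [Finset.prod_ite, Finset.prod_const, Finset.prod_const_one, mul_one,
      Finset.filter_mem_eq_inter, Finset.inter_eq_right.2 hFU]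
  have hUcard : U.card = R.card + 2 * B.card := by
    rw [← hUeq, Finset.card_union_of_disjoint hdis2, Finset.card_union_of_disjoint hdisj,
      Finset.card_image_of_injOn hinj]
    ring
  calc (𝓕.card : ℝ) ≤ (∏ x ∈ R, ((𝓕.image (· ∩ β x)).card : ℝ)) *
        ∏ x ∈ B, ((𝓕.image (· ∩ β x)).card : ℝ) := by exact_mod_cast h1
    _ ≤ (∏ x ∈ R, 2 * w x) * ∏ x ∈ B, 3 * (w x * w (x + m)) := by
      refine mul_le_mul (Finset.prod_le_prod (fun _ _ => by positivity) hsingle)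
        (Finset.prod_le_prod (fun _ _ => by positivity) hpair)
        (Finset.prod_nonneg fun _ _ => by positivity) ?_
      exact Finset.prod_nonneg fun x _ => by simp only [w]; split_ifs <;> norm_num
    _ = 2 ^ R.card * 3 ^ B.card * (2 / 3) ^ F.card := by
      rw [← hw, Finset.prod_mul_distrib, Finset.prod_mul_distrib, Finset.prod_const,
        Finset.prod_const]
      ring
    _ = _ := by
      rw [hUcard, pow_add, pow_mul, mul_assoc (2 ^ R.card) ((2 ^ 2) ^ B.card), ← mul_pow]
      norm_num

/-- Bound for the traces with least element `m` and prescribed part `A` below `f / 2`. -/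
theorem card_tracesWithMin_filter_le (f m : ℕ) (hfm : f < 4 * m) (hm : 2 * m < f)
    (A : Finset ℕ) (hA : A ⊆ Finset.Icc m ((f - 1) / 2)) (hA0 : A.Nonempty) :
    ((((tracesWithMin f m).filter fun T => T ∩ Finset.Icc m ((f - 1) / 2) = A).card : ℕ) : ℝ)
      ≤ 2 ^ ((f - 1) / 2) * (3 / 4) ^ ((f - 1) / 2 - m) * (2 / 3) ^ (3 * A.card - 1) := by
  set 𝓕 := (tracesWithMin f m).filter fun T => T ∩ Finset.Icc m ((f - 1) / 2) = A with h𝓕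
  rcases 𝓕.eq_empty_or_nonempty with h0 | ⟨T₀, hT₀⟩
  · rw [h0]
    simp only [Finset.card_empty, Nat.cast_zero]
    positivity
  have hAm : ∀ a ∈ A, m ≤ a ∧ 2 * a < f := by
    intro a ha
    have := Finset.mem_Icc.1 (hA ha)
    omega
  have hmem : ∀ T ∈ 𝓕, (∀ x ∈ T, 0 < x ∧ x < f) ∧
      (∀ x ∈ T, ∀ y ∈ T, x + y ≠ f ∧ (x + y < f → x + y ∈ T)) ∧ m ∈ T ∧ (∀ x ∈ T, m ≤ x) ∧
      A ⊆ T ∧ ∀ x ∈ T, 2 * x < f → x ∈ A := by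
    intro T hT
    obtain ⟨hT, hTA⟩ := Finset.mem_filter.1 hT
    obtain ⟨hT, hmT, hmin⟩ := mem_tracesWithMin.1 hT
    obtain ⟨h1, h2⟩ := mem_traces.1 hT
    refine ⟨h1, h2, hmT, hmin, hTA ▸ Finset.inter_subset_left, fun x hx hxf => ?_⟩
    rw [← hTA]
    have := hmin x hx
    exact Finset.mem_inter.2 ⟨hx, Finset.mem_Icc.2 ⟨this, by omega⟩⟩
  -- Prescribing `A` excludes every `f - a` and forces every `a + b`. These sets are disjoint, since
  -- three elements of a trace cannot sum to `f`, and `#(A + A) ≥ 2 #A - 1`.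
  set F := A.image (fun a => f - a) ∪ (A + A) with hFdef
  have hFcard : 3 * A.card - 1 ≤ F.card := by
    rw [hFdef, Finset.card_union_of_disjoint, Finset.card_image_of_injOn]
    · have := cauchy_davenport_add_of_linearOrder_isCancelAdd hA0 hA0
      omega
    · intro a ha b hb hab
      have := hAm a ha
      have := hAm b hb
      simp only at hab
      omega
    · rw [Finset.disjoint_left]
      intro x hx hx'
      obtain ⟨a, ha, rfl⟩ := Finset.mem_image.1 hx
      obtain ⟨b, hb, c, hc, hbc⟩ := Finset.mem_add.1 hx'
      obtain ⟨-, h2, -, -, hAT, -⟩ := hmem T₀ hT₀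
      have := hAm a ha
      have := hAm b hb
      have := hAm c hc
      have h3 := (h2 b (hAT hb) c (hAT hc)).2 (by omega)
      exact (h2 _ h3 a (hAT ha)).1 (by omega)
  -- The translate of `(f/2, f - m)` by `m` is disjoint from it because `f < 4 * m`.
  have hmain := card_le_of_translate_closed 𝓕 (Finset.Ioo (f / 2) f)
    (Finset.Ioo (f / 2) (f - m)) F m
    (by
      intro x
      simp only [Finset.mem_Ioo]
      omega)
    (by
      intro x hx
      obtain ⟨b, hb, rfl⟩ := Finset.mem_image.1 hx
      simp only [Finset.mem_Ioo] at hb ⊢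
      omega)
    (by
      rw [Finset.disjoint_left]
      intro x hx hx'
      obtain ⟨b, hb, rfl⟩ := Finset.mem_image.1 hx'
      simp only [Finset.mem_Ioo] at hb hx
      omega)
    (by
      have hsub : ∀ T ∈ 𝓕, ∀ T' ∈ 𝓕, T ∩ Finset.Ioo (f / 2) f = T' ∩ Finset.Ioo (f / 2) f →
          T ⊆ T' := by
        intro T hT T' hT' h x hx
        obtain ⟨h1, h2, -, -, -, hTA⟩ := hmem T hT
        have hxf := h1 x hx
        rcases lt_trichotomy (2 * x) f with hlt | heq | hgt
        · exact (hmem T' hT').2.2.2.2.1 (hTA x hx hlt)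
        · exact absurd (by omega) (h2 x hx x hx).1
        · have : x ∈ T ∩ Finset.Ioo (f / 2) f :=
            Finset.mem_inter.2 ⟨hx, Finset.mem_Ioo.2 (by omega)⟩
          rw [h] at this
          exact (Finset.mem_inter.1 this).1
      exact fun T hT T' hT' h => (hsub T hT T' hT' h).antisymm (hsub T' hT' T hT h.symm))
    (by
      intro T hT b hb hbT
      obtain ⟨-, h2, hmT, -⟩ := hmem T hT
      rw [Finset.mem_Ioo] at hb
      exact (h2 b hbT m hmT).2 (by omega))
    (by
      intro x hx
      rw [Finset.mem_Ioo]
      rcases Finset.mem_union.1 hx with hx | hx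
      · obtain ⟨a, ha, rfl⟩ := Finset.mem_image.1 hx
        have := hAm a ha
        omega
      · obtain ⟨b, hb, c, hc, rfl⟩ := Finset.mem_add.1 hx
        have := hAm b hb
        have := hAm c hc
        omega)
    (by
      intro x hx T hT T' hT' hxT
      rcases Finset.mem_union.1 hx with hx | hx
      · obtain ⟨a, ha, rfl⟩ := Finset.mem_image.1 hx
        obtain ⟨-, h2, -, -, hAT, -⟩ := hmem T hT
        have := hAm a ha
        exact absurd (by omega) (h2 _ hxT a (hAT ha)).1
      · obtain ⟨b, hb, c, hc, rfl⟩ := Finset.mem_add.1 hx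
        obtain ⟨-, h2, -, -, hAT, -⟩ := hmem T' hT'
        have := hAm b hb
        have := hAm c hc
        exact (h2 b (hAT hb) c (hAT hc)).2 (by omega))
  rw [Nat.card_Ioo, Nat.card_Ioo, show f - f / 2 - 1 = (f - 1) / 2 by omega,
    show f - m - f / 2 - 1 = (f - 1) / 2 - m by omega] at hmain
  refine hmain.trans (mul_le_mul_of_nonneg_left ?_ (by positivity))
  exact pow_le_pow_of_le_one (by norm_num) (by norm_num) hFcard

/-- The previous bound is summed over `A = {m} ∪ A'`. Each element of `A'` costs `(2/3) ^ 3 = 8/27`,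
so the binomial theorem gives the ratio `(3/4) * (1 + 8/27) = 35/36`, crucially below `1`. -/
theorem card_tracesWithMin_le (f m : ℕ) (hfm : f < 4 * m) (hm : 2 * m < f) :
    ((tracesWithMin f m).card : ℝ) ≤ 2 ^ ((f - 1) / 2) * (35 / 36) ^ ((f - 1) / 2 - m) := by
  set n := (f - 1) / 2 with hn
  have hmaps : Set.MapsTo (fun T => (T ∩ Finset.Ioc m n)) (tracesWithMin f m : Set (Finset ℕ))
      ((Finset.Ioc m n).powerset : Set (Finset ℕ)) := by
    intro T _
    simp
  have hfib : ∀ A' ∈ (Finset.Ioc m n).powerset,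
      ((((tracesWithMin f m).filter fun T => T ∩ Finset.Ioc m n = A').card : ℕ) : ℝ)
        ≤ 2 ^ n * (3 / 4) ^ (n - m) * (4 / 9) * (8 / 27) ^ A'.card := by
    intro A' hA'
    rw [Finset.mem_powerset] at hA'
    have hmA' : m ∉ A' := fun h => by
      have := Finset.mem_Ioc.1 (hA' h)
      omega
    have h := card_tracesWithMin_filter_le f m hfm hm (insert m A') (by
      intro x hx
      rw [Finset.mem_insert] at hx
      rw [Finset.mem_Icc]
      rcases hx with rfl | hx
      · omega
      · have := Finset.mem_Ioc.1 (hA' hx)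
        omega) (Finset.insert_nonempty _ _)
    rw [← hn, Finset.card_insert_of_notMem hmA',
      show 3 * (A'.card + 1) - 1 = 2 + 3 * A'.card by omega, pow_add, pow_mul] at h
    refine le_trans ?_ (h.trans_eq ?_)
    · refine Nat.cast_le.2 (Finset.card_le_card fun T hT => ?_)
      rw [Finset.mem_filter] at hT ⊢
      refine ⟨hT.1, ?_⟩
      rw [← hT.2]
      have hmT := (mem_tracesWithMin.1 hT.1).2.1
      ext x
      simp only [Finset.mem_inter, Finset.mem_insert, Finset.mem_Icc, Finset.mem_Ioc]
      constructor
      · rintro ⟨hx, hmx, hxn⟩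
        rcases hmx.eq_or_lt with h | h
        · exact Or.inl h.symm
        · exact Or.inr ⟨hx, h, hxn⟩
      · rintro (rfl | ⟨hx, hmx, hxn⟩)
        · exact ⟨hmT, le_rfl, by omega⟩
        · exact ⟨hx, hmx.le, hxn⟩
    · norm_num
      ring
  calc ((tracesWithMin f m).card : ℝ)
      = ∑ A' ∈ (Finset.Ioc m n).powerset,
        ((((tracesWithMin f m).filter fun T => T ∩ Finset.Ioc m n = A').card : ℕ) : ℝ) := by
        exact_mod_cast Finset.card_eq_sum_card_fiberwise hmaps
    _ ≤ ∑ A' ∈ (Finset.Ioc m n).powerset,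
        2 ^ n * (3 / 4) ^ (n - m) * (4 / 9) * (8 / 27) ^ A'.card := Finset.sum_le_sum hfib
    _ = 2 ^ n * (4 / 9) * (35 / 36) ^ (n - m) := by
      rw [← Finset.mul_sum]
      have h := Finset.sum_pow_mul_eq_add_pow (8 / 27 : ℝ) 1 (Finset.Ioc m n)
      simp only [one_pow, mul_one, Nat.card_Ioc] at h
      rw [h, show (35 / 36 : ℝ) = 3 / 4 * (8 / 27 + 1) by norm_num, mul_pow]
      ring
    _ ≤ _ := by
      refine mul_le_mul_of_nonneg_right ?_ (by positivity)
      have : (0 : ℝ) < 2 ^ n := by positivity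
      linarith

/-! ### Rarity of traces with small least element -/

theorem two_pow_le_card_traces (f : ℕ) (hf : 0 < f) : 2 ^ ((f - 1) / 2) ≤ (traces f).card := by
  have h : (Finset.Ioo (f / 2) f).powerset ⊆ traces f := by
    intro T hT
    rw [Finset.mem_powerset] at hT
    have hT' : ∀ x ∈ T, f / 2 < x ∧ x < f := fun x hx => Finset.mem_Ioo.1 (hT hx)
    refine mem_traces.2 ⟨fun x hx => ?_, fun x hx y hy => ?_⟩
    · have := hT' x hx
      omega
    · have := hT' x hx
      have := hT' y hy
      exact ⟨by omega, fun h => by omega⟩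
  have := Finset.card_le_card h
  rwa [Finset.card_powerset, Nat.card_Ioo, show f - f / 2 - 1 = (f - 1) / 2 by omega] at this

/-- The traces all of whose elements are at least `(f - 1) / 2 - K`. -/
def goodTraces (f K : ℕ) : Finset (Finset ℕ) :=
  {T ∈ traces f | ∀ x ∈ T, (f - 1) / 2 ≤ x + K}

theorem mem_goodTraces {f K : ℕ} {T : Finset ℕ} :
    T ∈ goodTraces f K ↔ T ∈ traces f ∧ ∀ x ∈ T, (f - 1) / 2 ≤ x + K := by
  simp [goodTraces]

theorem goodTraces_subset (f K : ℕ) : goodTraces f K ⊆ traces f := Finset.filter_subset _ _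

theorem card_tracesWithMin_le_of_lt (f m : ℕ) (hm : m < (f - 1) / 2) :
    ((tracesWithMin f m).card : ℝ) ≤
      (1403 / 1000) ^ f + 2 ^ ((f - 1) / 2) * (35 / 36) ^ ((f - 1) / 2 - m) := by
  have h1 : (0 : ℝ) ≤ (1403 / 1000) ^ f := by positivity
  have h2 : (0 : ℝ) ≤ 2 ^ ((f - 1) / 2) * (35 / 36) ^ ((f - 1) / 2 - m) := by positivity
  -- The number `1403/1000` slightly exceeds `15 ^ (1/8)`. The case `4 * m = f` is void because `m +
  -- 3 * m = f`.
  rcases lt_trichotomy (4 * m) f with hlt | heq | hgt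
  · refine le_add_of_le_of_nonneg ?_ h2
    refine le_of_pow_le_pow_left₀ (n := 8) (by norm_num) h1 ?_
    have h3 : ((tracesWithMin f m).card : ℝ) ^ 8 ≤ 15 ^ f := by
      exact_mod_cast card_tracesWithMin_pow_le f m hlt
    refine h3.trans ?_
    rw [← pow_mul, mul_comm, pow_mul]
    exact pow_le_pow_left₀ (by norm_num) (by norm_num) f
  · have : tracesWithMin f m = ∅ := by
      refine Finset.eq_empty_of_forall_notMem fun T hT => ?_
      refine (add_mul_mem hT (mem_tracesWithMin.1 hT).2.1 3).1 ?_
      omega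
    rw [this]
    simpa using add_nonneg h1 h2
  · exact (card_tracesWithMin_le f m hgt (by omega)).trans (le_add_of_nonneg_left h1)

theorem card_traces_sdiff_goodTraces_le (f K : ℕ) :
    ((traces f \ goodTraces f K).card : ℝ) ≤
      ((f - 1) / 2 : ℕ) * (1403 / 1000) ^ f + 2 ^ ((f - 1) / 2) * (36 * (35 / 36) ^ K) := by
  set n := (f - 1) / 2 with hn
  have hsub : traces f \ goodTraces f K ⊆ (Finset.range (n - K)).biUnion (tracesWithMin f) := by
    intro T hT
    rw [Finset.mem_sdiff, mem_goodTraces] at hT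
    obtain ⟨hT, hT'⟩ := hT
    have hex : ∃ x ∈ T, x + K < n := by
      by_contra! hc
      exact hT' ⟨hT, hc⟩
    obtain ⟨x, hx, hxK⟩ := hex
    have hne : T.Nonempty := ⟨x, hx⟩
    have hmx := T.min'_le x hx
    refine Finset.mem_biUnion.2 ⟨T.min' hne, Finset.mem_range.2 (by omega),
      mem_tracesWithMin.2 ⟨hT, T.min'_mem hne, fun y hy => T.min'_le y hy⟩⟩
  have hgeom : ∑ m ∈ Finset.range (n - K), (35 / 36 : ℝ) ^ (n - m) ≤ 36 * (35 / 36) ^ K := by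
    rcases le_total n K with h | h
    · rw [Nat.sub_eq_zero_of_le h]
      simp only [Finset.range_zero, Finset.sum_empty]
      positivity
    obtain ⟨d, hd⟩ : ∃ d, n = K + d := ⟨n - K, by omega⟩
    rw [hd]
    have : ∀ m ∈ Finset.range (K + d - K),
        (35 / 36 : ℝ) ^ (K + d - m) = (35 / 36) ^ (K + 1) * (35 / 36) ^ (d - 1 - m) := by
      intro m hm
      rw [Finset.mem_range] at hm
      rw [← pow_add]
      congr 1
      omega
    rw [Finset.sum_congr rfl this, ← Finset.mul_sum, show K + d - K = d by omega,
      Finset.sum_range_reflect (fun j => (35 / 36 : ℝ) ^ j) d, geom_sum_eq (by norm_num)]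
    have h1 : (0 : ℝ) ≤ (35 / 36) ^ d := by positivity
    have h2 : (0 : ℝ) ≤ (35 / 36) ^ K := by positivity
    have h3 := mul_nonneg h2 h1
    rw [pow_succ, show ((35 / 36 : ℝ) ^ d - 1) / (35 / 36 - 1) = 36 * (1 - (35 / 36) ^ d) by ring]
    linarith
  calc ((traces f \ goodTraces f K).card : ℝ)
      ≤ ∑ m ∈ Finset.range (n - K), ((tracesWithMin f m).card : ℝ) := by
        exact_mod_cast (Finset.card_le_card hsub).trans Finset.card_biUnion_le
    _ ≤ ∑ m ∈ Finset.range (n - K), ((1403 / 1000) ^ f + 2 ^ n * (35 / 36) ^ (n - m)) := by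
        refine Finset.sum_le_sum fun m hm => card_tracesWithMin_le_of_lt f m ?_
        rw [Finset.mem_range] at hm
        omega
    _ = (n - K : ℕ) * (1403 / 1000) ^ f
        + 2 ^ n * ∑ m ∈ Finset.range (n - K), (35 / 36 : ℝ) ^ (n - m) := by
        rw [Finset.sum_add_distrib, ← Finset.mul_sum]
        simp
    _ ≤ _ := by
        gcongr
        omega

theorem card_sdiff_goodTraces_div_le (f K : ℕ) (hf : 0 < f) :
    ((traces f \ goodTraces f K).card : ℝ) / (traces f).card ≤
      2 * (((f - 1) / 2 : ℕ) * (197 / 200) ^ ((f - 1) / 2)) + 36 * (35 / 36) ^ K := by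
  have hN : (2 : ℝ) ^ ((f - 1) / 2) ≤ (traces f).card := by
    exact_mod_cast two_pow_le_card_traces f hf
  have hN0 : (0 : ℝ) < (traces f).card := lt_of_lt_of_le (by positivity) hN
  have h1 := card_traces_sdiff_goodTraces_le f K
  rw [div_le_iff₀ hN0]
  set n := (f - 1) / 2 with hn
  -- Here `f ≤ 2 * n + 2`, and `(1403/1000) ^ 2` is still below `2 * (197/200)`.
  have h2 : (1403 / 1000 : ℝ) ^ f ≤ 2 ^ n * (2 * (197 / 200) ^ n) := by
    calc (1403 / 1000 : ℝ) ^ f ≤ (1403 / 1000) ^ (2 * n + 2) :=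
          pow_le_pow_right₀ (by norm_num) (by omega)
      _ = ((1403 / 1000) ^ 2) ^ n * (1403 / 1000) ^ 2 := by rw [pow_add, pow_mul]
      _ ≤ (2 * (197 / 200)) ^ n * 2 := by
          gcongr <;> norm_num
      _ = _ := by rw [mul_pow]; ring
  calc _ ≤ (n : ℝ) * (1403 / 1000) ^ f + 2 ^ n * (36 * (35 / 36) ^ K) := h1
    _ ≤ n * (2 ^ n * (2 * (197 / 200) ^ n)) + 2 ^ n * (36 * (35 / 36) ^ K) := by gcongr
    _ = (2 * (n * (197 / 200) ^ n) + 36 * (35 / 36) ^ K) * 2 ^ n := by ring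
    _ ≤ _ := by gcongr

/-! ### Good traces as core plus free window -/

/-- The elements that can be freely added to or removed from a good trace. -/
def freeWindow (f K : ℕ) : Finset ℕ :=
  Finset.Ioo ((f - 1) / 2 + 2 + K) (2 * ((f - 1) / 2) - 2 * K)

/-- The good traces that are disjoint from the free window. -/
def coreTraces (f K : ℕ) : Finset (Finset ℕ) :=
  {T ∈ goodTraces f K | Disjoint T (freeWindow f K)}

theorem mem_coreTraces {f K : ℕ} {T : Finset ℕ} :
    T ∈ coreTraces f K ↔ T ∈ goodTraces f K ∧ Disjoint T (freeWindow f K) := by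
  simp [coreTraces]

/-- Two elements of a good trace sum to at least `2n - 2K`, the upper end of the window, so no sum
ever forces a window element. -/
theorem sdiff_freeWindow_mem {f K : ℕ} {T : Finset ℕ} (hT : T ∈ goodTraces f K) :
    T \ freeWindow f K ∈ coreTraces f K := by
  obtain ⟨hT, hK⟩ := mem_goodTraces.1 hT
  obtain ⟨h1, h2⟩ := mem_traces.1 hT
  refine mem_coreTraces.2 ⟨mem_goodTraces.2 ⟨mem_traces.2 ⟨?_, ?_⟩, ?_⟩, Finset.sdiff_disjoint⟩
  · exact fun x hx => h1 x (Finset.mem_sdiff.1 hx).1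
  · intro x hx y hy
    have hx := (Finset.mem_sdiff.1 hx).1
    have hy := (Finset.mem_sdiff.1 hy).1
    refine ⟨(h2 x hx y hy).1, fun h => Finset.mem_sdiff.2 ⟨(h2 x hx y hy).2 h, fun hW => ?_⟩⟩
    have := Finset.mem_Ioo.1 hW
    have := hK x hx
    have := hK y hy
    omega
  · exact fun x hx => hK x (Finset.mem_sdiff.1 hx).1

/-- A window element plus an element of at least `n - K` exceeds `2n + 2 ≥ f`, so it creates no
constraint. -/
theorem union_mem_goodTraces {f K : ℕ} {T V : Finset ℕ} (hT : T ∈ goodTraces f K)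
    (hV : V ⊆ freeWindow f K) : T ∪ V ∈ goodTraces f K := by
  obtain ⟨hT, hK⟩ := mem_goodTraces.1 hT
  obtain ⟨h1, h2⟩ := mem_traces.1 hT
  have hV' : ∀ x ∈ V, (f - 1) / 2 + 2 + K < x ∧ x < 2 * ((f - 1) / 2) - 2 * K :=
    fun x hx => Finset.mem_Ioo.1 (hV hx)
  refine mem_goodTraces.2 ⟨mem_traces.2 ⟨fun x hx => ?_, fun x hx y hy => ?_⟩, fun x hx => ?_⟩
  · rcases Finset.mem_union.1 hx with hx | hx
    · exact h1 x hx
    · have := hV' x hx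
      omega
  · rcases Finset.mem_union.1 hx with hx | hx
    · rcases Finset.mem_union.1 hy with hy | hy
      · exact ⟨(h2 x hx y hy).1, fun h => Finset.mem_union_left _ ((h2 x hx y hy).2 h)⟩
      · have := hK x hx
        have := hV' y hy
        exact ⟨by omega, fun h => by omega⟩
    · have hx := hV' x hx
      rcases Finset.mem_union.1 hy with hy | hy
      · have := hK y hy
        exact ⟨by omega, fun h => by omega⟩
      · have := hV' y hy
        exact ⟨by omega, fun h => by omega⟩
  · rcases Finset.mem_union.1 hx with hx | hx
    · exact hK x hx
    · have := hV' x hx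
      omega

/-- Stated over a semiring to serve twice: `ζ = 1` in `ℕ` counts the good traces, and `ζ = exp
(-is)` in `ℂ` gives their characteristic function. -/
theorem sum_goodTraces_pow_card {R : Type*} [CommSemiring R] (f K : ℕ) (ζ : R) :
    ∑ T ∈ goodTraces f K, ζ ^ T.card =
      (∑ T ∈ coreTraces f K, ζ ^ T.card) * (1 + ζ) ^ (freeWindow f K).card := by
  have h := Finset.sum_pow_mul_eq_add_pow ζ 1 (freeWindow f K)
  simp only [one_pow, mul_one] at h
  rw [add_comm 1 ζ, ← h, Finset.sum_mul_sum, ← Finset.sum_product']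
  refine Finset.sum_bij' (fun T _ => (T \ freeWindow f K, T ∩ freeWindow f K))
    (fun p _ => p.1 ∪ p.2) ?_ ?_ ?_ ?_ ?_
  · intro T hT
    exact Finset.mem_product.2 ⟨sdiff_freeWindow_mem hT,
      Finset.mem_powerset.2 Finset.inter_subset_right⟩
  · intro p hp
    rw [Finset.mem_product, Finset.mem_powerset, mem_coreTraces] at hp
    exact union_mem_goodTraces hp.1.1 hp.2
  · intro T _
    exact Finset.sdiff_union_inter T _
  · rintro ⟨T, V⟩ hp
    rw [Finset.mem_product, Finset.mem_powerset, mem_coreTraces] at hp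
    obtain ⟨⟨-, hT⟩, hV⟩ := hp
    simp only at hT hV
    refine Prod.ext ?_ ?_
    · simp only
      rw [Finset.union_sdiff_distrib, Finset.sdiff_eq_self_of_disjoint hT,
        Finset.sdiff_eq_empty_iff_subset.2 hV, Finset.union_empty]
    · simp only
      rw [Finset.union_inter_distrib_right, Finset.disjoint_iff_inter_eq_empty.1 hT,
        Finset.inter_eq_left.2 hV, Finset.empty_union]
  · intro T _
    simp only
    rw [← pow_add, Finset.card_sdiff_add_card_inter]

theorem card_freeWindow (f K : ℕ) : (freeWindow f K).card = (f - 1) / 2 - 3 * K - 3 := by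
  rw [freeWindow, Nat.card_Ioo]
  omega

theorem card_le_of_mem_coreTraces {f K : ℕ} {T : Finset ℕ} (hT : T ∈ coreTraces f K) :
    T.card ≤ 4 * K + 5 := by
  obtain ⟨hT, hW⟩ := mem_coreTraces.1 hT
  obtain ⟨hT, hK⟩ := mem_goodTraces.1 hT
  have hsub : T ⊆ Finset.Icc ((f - 1) / 2 - K) ((f - 1) / 2 + 2 + K) ∪
      Finset.Ico (2 * ((f - 1) / 2) - 2 * K) f := by
    intro x hx
    have h1 := (mem_traces.1 hT).1 x hx
    have h2 := hK x hx
    have h3 : x ∉ freeWindow f K := Finset.disjoint_left.1 hW hx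
    rw [freeWindow, Finset.mem_Ioo] at h3
    rw [Finset.mem_union, Finset.mem_Icc, Finset.mem_Ico]
    omega
  have h := (Finset.card_le_card hsub).trans (Finset.card_union_le _ _)
  rw [Nat.card_Icc, Nat.card_Ico] at h
  omega

theorem abs_card_add_half_card_freeWindow_le {f K : ℕ} (hf : 0 < f) {T : Finset ℕ}
    (hT : T ∈ coreTraces f K) :
    |(f : ℝ) / 4 - T.card - (freeWindow f K).card / 2| ≤ 4 * K + 5 := by
  have h1 := card_le_of_mem_coreTraces hT
  have h2 := card_freeWindow f K
  have h3 : f ≤ 2 * (freeWindow f K).card + 6 * K + 8 := by omega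
  have h4 : 2 * (freeWindow f K).card ≤ f := by omega
  have h1' : (T.card : ℝ) ≤ 4 * K + 5 := by exact_mod_cast h1
  have h3' : (f : ℝ) ≤ 2 * (freeWindow f K).card + 6 * K + 8 := by exact_mod_cast h3
  have h4' : 2 * ((freeWindow f K).card : ℝ) ≤ f := by exact_mod_cast h4
  have h5 : (0 : ℝ) ≤ T.card := by positivity
  have h6 : (0 : ℝ) ≤ K := by positivity
  rw [abs_le]
  constructor <;> linarith

/-! ### Dictionary between semigroups and traces -/

/-- The trace on `(0, f)` of a numerical semigroup. -/
noncomputable def trace (f : ℕ) (S : NumericalSemigroup) : Finset ℕ := by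
  classical exact {x ∈ Finset.Ioo 0 f | x ∈ S}

theorem mem_trace {f : ℕ} {S : NumericalSemigroup} {x : ℕ} :
    x ∈ trace f S ↔ (0 < x ∧ x < f) ∧ x ∈ S := by
  simp [trace]

theorem add_mem_of_mem {S : NumericalSemigroup} {x y : ℕ} (hx : x ∈ S) (hy : y ∈ S) :
    x + y ∈ S := S.toAddSubmonoid.add_mem hx hy

theorem zero_mem' (S : NumericalSemigroup) : 0 ∈ S := S.toAddSubmonoid.zero_mem

theorem mem_withFrobenius {f : ℕ} {S : NumericalSemigroup} :
    S ∈ withFrobenius f ↔ f ∉ S ∧ ∀ x, f < x → x ∈ S := by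
  change S.frobenius = f ↔ _
  rw [frobenius_eq_iff]
  constructor
  · rintro ⟨h1, h2⟩
    refine ⟨h1, fun x hx => ?_⟩
    by_contra h
    exact absurd (h2 h) (not_le.2 hx)
  · rintro ⟨h1, h2⟩
    refine ⟨h1, fun x hx => ?_⟩
    by_contra h
    exact hx (h2 x (not_le.1 h))

theorem trace_mem_traces {f : ℕ} {S : NumericalSemigroup} (hS : S ∈ withFrobenius f) :
    trace f S ∈ traces f := by
  obtain ⟨h1, h2⟩ := mem_withFrobenius.1 hS
  refine mem_traces.2 ⟨fun x hx => (mem_trace.1 hx).1, fun x hx y hy => ?_⟩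
  rw [mem_trace] at hx hy
  have h := add_mem_of_mem hx.2 hy.2
  exact ⟨fun he => h1 (he ▸ h), fun hlt => mem_trace.2 ⟨by omega, h⟩⟩

theorem trace_injOn (f : ℕ) : Set.InjOn (trace f) (withFrobenius f) := by
  intro S hS S' hS' h
  obtain ⟨h1, h2⟩ := mem_withFrobenius.1 hS
  obtain ⟨h1', h2'⟩ := mem_withFrobenius.1 hS'
  refine SetLike.ext fun x => ?_
  have hx := Finset.ext_iff.1 h x
  rw [mem_trace, mem_trace] at hx
  rcases Nat.eq_zero_or_pos x with rfl | h0
  · exact iff_of_true (zero_mem' S) (zero_mem' S')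
  rcases lt_trichotomy x f with hlt | rfl | hgt
  · tauto
  · exact iff_of_false h1 h1'
  · exact iff_of_true (h2 x hgt) (h2' x hgt)

theorem exists_trace_eq {f : ℕ} (hf : 0 < f) {T : Finset ℕ} (hT : T ∈ traces f) :
    ∃ S ∈ withFrobenius f, trace f S = T := by
  obtain ⟨h1, h2⟩ := mem_traces.1 hT
  let M : AddSubmonoid ℕ :=
    { carrier := {x | x = 0 ∨ x ∈ T ∨ f < x}
      zero_mem' := Or.inl rfl
      add_mem' := by
        intro x y hx hy
        simp only [Set.mem_ofPred_eq] at hx hy ⊢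
        rcases hx with rfl | hx | hx
        · simpa using hy
        · rcases hy with rfl | hy | hy
          · simp [hx]
          · have := h2 x hx y hy
            rcases lt_trichotomy (x + y) f with h | h | h
            · exact Or.inr (Or.inl (this.2 h))
            · exact absurd h this.1
            · exact Or.inr (Or.inr h)
          · omega
        · omega }
  have hM : ∀ x, x ∈ M ↔ x = 0 ∨ x ∈ T ∨ f < x := fun x => Iff.rfl
  have hfin : ((M : Set ℕ)ᶜ).Finite := by
    refine (Set.finite_Iic f).subset fun x hx => ?_
    by_contra h
    exact hx (Or.inr (Or.inr (not_le.1 h)))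
  have hS : ∀ x, x ∈ (⟨M, hfin⟩ : NumericalSemigroup) ↔ x = 0 ∨ x ∈ T ∨ f < x := hM
  refine ⟨⟨M, hfin⟩, mem_withFrobenius.2 ⟨?_, fun x hx => (hS x).2 (Or.inr (Or.inr hx))⟩, ?_⟩
  · rw [hS]
    rintro (h | h | h)
    · omega
    · exact absurd (h1 f h).2 (lt_irrefl f)
    · omega
  · ext x
    rw [mem_trace, hS]
    constructor
    · rintro ⟨h, h' | h' | h'⟩
      · omega
      · exact h'
      · omega
    · exact fun h => ⟨h1 x h, Or.inr (Or.inl h)⟩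

theorem genus_add_card_trace {f : ℕ} (hf : 0 < f) {S : NumericalSemigroup}
    (hS : S ∈ withFrobenius f) : S.genus + (trace f S).card = f := by
  obtain ⟨h1, h2⟩ := mem_withFrobenius.1 hS
  have hc : ((S : Set ℕ)ᶜ) = ((Finset.Ioc 0 f \ trace f S : Finset ℕ) : Set ℕ) := by
    ext x
    simp only [Set.mem_compl_iff, SetLike.mem_coe, Finset.coe_sdiff, Finset.coe_Ioc, Set.mem_sdiff,
      Set.mem_Ioc, mem_trace]
    constructor
    · intro hx
      have : x ≠ 0 := fun h => hx (h ▸ zero_mem' S)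
      have : ¬ f < x := fun h => hx (h2 x h)
      exact ⟨by omega, fun h => hx h.2⟩
    · rintro ⟨hx, hxT⟩ hxS
      rcases hx.2.eq_or_lt with rfl | h
      · exact h1 hxS
      · exact hxT ⟨⟨hx.1, h⟩, hxS⟩
  have hsub : trace f S ⊆ Finset.Ioc 0 f := fun x hx => by
    have := (mem_trace.1 hx).1
    exact Finset.mem_Ioc.2 ⟨this.1, this.2.le⟩
  rw [genus, hc, Set.ncard_coe_finset]
  have := Finset.card_sdiff_add_card_eq_card hsub
  simpa using this

theorem sum_toFinset_withFrobenius {E : Type*} [AddCommMonoid E] {f : ℕ} (hf : 0 < f)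
    (F : NumericalSemigroup → E) (G : Finset ℕ → E)
    (hFG : ∀ S ∈ withFrobenius f, F S = G (trace f S)) :
    ∑ S ∈ (withFrobenius_finite f).toFinset, F S = ∑ T ∈ traces f, G T := by
  refine Finset.sum_bij (fun S _ => trace f S) ?_ ?_ ?_ ?_
  · exact fun S hS => trace_mem_traces ((Set.Finite.mem_toFinset _).1 hS)
  · exact fun S hS S' hS' h => trace_injOn f ((Set.Finite.mem_toFinset _).1 hS)
      ((Set.Finite.mem_toFinset _).1 hS') h
  · intro T hT
    obtain ⟨S, hS, rfl⟩ := exists_trace_eq hf hT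
    exact ⟨S, (Set.Finite.mem_toFinset _).2 hS, rfl⟩
  · exact fun S hS => hFG S ((Set.Finite.mem_toFinset _).1 hS)

theorem integral_uniformLaw (f : ℕ+) (F : NumericalSemigroup → ℂ) (G : Finset ℕ → ℂ)
    (hFG : ∀ S ∈ withFrobenius (f : ℕ), F S = G (trace f S)) :
    ∫ S, F S ∂(uniformLaw f) = ((traces f).card : ℂ)⁻¹ * ∑ T ∈ traces f, G T := by
  have hcoe : withFrobenius ((f : ℕ) : ℤ) = ((withFrobenius_finite f).toFinset : Set _) := by simp
  have hcard : (withFrobenius_finite f).toFinset.card = (traces f).card := by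
    have := sum_toFinset_withFrobenius f.pos (fun _ => 1) (fun _ => 1) (fun _ _ => rfl)
    simpa using this
  rw [← sum_toFinset_withFrobenius f.pos F G hFG, uniformLaw, uniformOn, ProbabilityTheory.cond]
  generalize (withFrobenius_finite f).toFinset = s at hcoe hcard ⊢
  rw [integral_smul_measure, hcoe, Measure.count_apply_finset, setIntegral_finset, hcard]
  · simp [Complex.real_smul]
  · rw [← (s : Set NumericalSemigroup).biUnion_of_singleton]
    simp [integrableOn_finset_iUnion]

/-! ### Characteristic function estimates -/

/-- The characteristic function of the normalized genus. -/
theorem charFun_map_uniformLaw (f : ℕ+) (t : ℝ) :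
    charFun ((uniformLaw f).map fun Λ : NumericalSemigroup =>
        (1 / √((f : ℕ) : ℝ)) * ((Λ.genus : ℝ) - 3 * ((f : ℕ) : ℝ) / 4)) t =
      ((traces f).card : ℂ)⁻¹ * ∑ T ∈ traces f,
        Complex.exp (Complex.I * ((t / √((f : ℕ) : ℝ) * (((f : ℕ) : ℝ) / 4 - T.card) : ℝ) : ℂ)) := by
  rw [charFun_apply_real, integral_map (by fun_prop) (by fun_prop)]
  refine integral_uniformLaw f _ _ fun S hS => ?_
  have h : ((S.genus : ℝ) + (trace f S).card) = (f : ℕ) := by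
    exact_mod_cast genus_add_card_trace f.pos hS
  have h' : (S.genus : ℝ) = (f : ℕ) - (trace f S).card := by linarith
  rw [h', ← Complex.ofReal_mul, mul_comm]
  congr 3
  ring

theorem one_add_exp_neg (s : ℝ) :
    1 + Complex.exp (Complex.I * ((-s : ℝ) : ℂ)) =
      2 * (Real.cos (s / 2) : ℂ) * Complex.exp (Complex.I * ((-(s / 2) : ℝ) : ℂ)) := by
  rw [Complex.ofReal_cos, Complex.two_cos, add_mul, ← Complex.exp_add, ← Complex.exp_add]
  push_cast
  rw [← Complex.exp_zero]
  congr 2 <;> ring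

/-- Writing `1 + exp (-is) = 2 cos (s/2) exp (-is/2)` splits off the window's mean `w/2`. What
remains is a sum over cores of phases `s (f/4 - #T - w/2)`, each of size at most `|s| (4K + 5)`. -/
theorem norm_sum_goodTraces_sub_le (f K : ℕ) (hf : 0 < f) (s : ℝ) :
    ‖∑ T ∈ goodTraces f K, Complex.exp (Complex.I * ((s * ((f : ℝ) / 4 - T.card) : ℝ) : ℂ)) -
      (goodTraces f K).card * (Real.cos (s / 2) : ℂ) ^ (freeWindow f K).card‖ ≤
      (goodTraces f K).card * (|s| * (4 * K + 5)) := by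
  set w := (freeWindow f K).card with hw
  have hcard : (goodTraces f K).card = (coreTraces f K).card * 2 ^ w := by
    have := sum_goodTraces_pow_card f K (1 : ℕ)
    simpa [one_add_one_eq_two] using this
  have hsplit : ∀ T : Finset ℕ, Complex.exp (Complex.I * ((s * ((f : ℝ) / 4 - T.card) : ℝ) : ℂ)) =
      Complex.exp (Complex.I * ((s * ((f : ℝ) / 4) : ℝ) : ℂ)) *
        Complex.exp (Complex.I * ((-s : ℝ) : ℂ)) ^ T.card := by
    intro T
    rw [← Complex.exp_nat_mul, ← Complex.exp_add]
    push_cast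
    congr 1
    ring
  have hsum : ∑ T ∈ goodTraces f K, Complex.exp (Complex.I * ((s * ((f : ℝ) / 4 - T.card) : ℝ) : ℂ))
      = 2 ^ w * (Real.cos (s / 2) : ℂ) ^ w * ∑ T ∈ coreTraces f K,
        Complex.exp (Complex.I * ((s * ((f : ℝ) / 4 - T.card - w / 2) : ℝ) : ℂ)) := by
    simp only [hsplit]
    rw [← Finset.mul_sum, sum_goodTraces_pow_card, one_add_exp_neg, mul_pow, mul_pow,
      ← mul_assoc, Finset.mul_sum, Finset.sum_mul, Finset.mul_sum]
    refine Finset.sum_congr rfl fun T _ => ?_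
    have h3 : Complex.exp (Complex.I * ((s * ((f : ℝ) / 4 - T.card - w / 2) : ℝ) : ℂ)) =
        Complex.exp (Complex.I * ((s * ((f : ℝ) / 4) : ℝ) : ℂ)) *
        Complex.exp (Complex.I * ((-s : ℝ) : ℂ)) ^ T.card *
        Complex.exp (Complex.I * ((-(s / 2) : ℝ) : ℂ)) ^ w := by
      rw [← Complex.exp_nat_mul, ← Complex.exp_nat_mul, ← Complex.exp_add, ← Complex.exp_add]
      push_cast
      congr 1
      ring
    rw [h3]
    ring
  have hdiff : ∑ T ∈ goodTraces f K,
        Complex.exp (Complex.I * ((s * ((f : ℝ) / 4 - T.card) : ℝ) : ℂ)) -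
      (goodTraces f K).card * (Real.cos (s / 2) : ℂ) ^ w =
      2 ^ w * (Real.cos (s / 2) : ℂ) ^ w * ∑ T ∈ coreTraces f K,
        (Complex.exp (Complex.I * ((s * ((f : ℝ) / 4 - T.card - w / 2) : ℝ) : ℂ)) - 1) := by
    rw [hsum, hcard, Finset.sum_sub_distrib]
    simp only [Finset.sum_const, nsmul_eq_mul, mul_one]
    push_cast
    ring
  rw [hdiff, norm_mul, norm_mul, norm_pow, norm_pow, Complex.norm_real, Real.norm_eq_abs]
  have hcos : |Real.cos (s / 2)| ^ w ≤ 1 := pow_le_one₀ (abs_nonneg _) (Real.abs_cos_le_one _)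
  have hterm : ‖∑ T ∈ coreTraces f K,
      (Complex.exp (Complex.I * ((s * ((f : ℝ) / 4 - T.card - w / 2) : ℝ) : ℂ)) - 1)‖ ≤
      (coreTraces f K).card * (|s| * (4 * K + 5)) := by
    rw [← nsmul_eq_mul]
    refine norm_sum_le_of_le _ (fun T hT => ?_) |>.trans_eq (Finset.sum_const _)
    refine Real.norm_exp_I_mul_ofReal_sub_one_le.trans ?_
    rw [Real.norm_eq_abs, abs_mul]
    exact mul_le_mul_of_nonneg_left (abs_card_add_half_card_freeWindow_le hf hT) (abs_nonneg s)
  rw [hcard, Nat.cast_mul, Nat.cast_pow, Nat.cast_ofNat]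
  calc _ ≤ ‖(2 : ℂ)‖ ^ w * 1 * ((coreTraces f K).card * (|s| * (4 * K + 5))) := by gcongr
    _ = _ := by
      rw [Complex.norm_ofNat]
      ring

/-- Each bad trace contributes at most `2`, as both its phase and the cosine power have modulus at
most `1`. -/
theorem norm_inv_card_mul_sum_sub_le (f K : ℕ) (hf : 0 < f) (s : ℝ) :
    ‖((traces f).card : ℂ)⁻¹ * ∑ T ∈ traces f,
        Complex.exp (Complex.I * ((s * ((f : ℝ) / 4 - T.card) : ℝ) : ℂ)) -
      (Real.cos (s / 2) : ℂ) ^ (freeWindow f K).card‖ ≤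
      2 * (((traces f \ goodTraces f K).card : ℝ) / (traces f).card) + |s| * (4 * K + 5) := by
  have hN0 : (0 : ℝ) < (traces f).card := by
    exact_mod_cast lt_of_lt_of_le (by positivity) (two_pow_le_card_traces f hf)
  have hN : ((traces f).card : ℂ) ≠ 0 := by exact_mod_cast hN0.ne'
  set c : ℂ := (Real.cos (s / 2) : ℂ) ^ (freeWindow f K).card with hc
  have hc1 : ‖c‖ ≤ 1 := by
    rw [hc, norm_pow, Complex.norm_real]
    exact pow_le_one₀ (norm_nonneg _) (Real.abs_cos_le_one _)
  set e : Finset ℕ → ℂ :=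
    fun T => Complex.exp (Complex.I * ((s * ((f : ℝ) / 4 - T.card) : ℝ) : ℂ)) with he
  have he1 : ∀ T, ‖e T‖ = 1 := fun T => by
    rw [he]
    simp only
    rw [mul_comm, Complex.norm_exp_ofReal_mul_I]
  have hcard := Finset.card_sdiff_add_card_eq_card (goodTraces_subset f K)
  have hcard' : ((traces f).card : ℂ) =
      (traces f \ goodTraces f K).card + (goodTraces f K).card := by
    exact_mod_cast hcard.symm
  have hsum : ((traces f).card : ℂ) * (((traces f).card : ℂ)⁻¹ * ∑ T ∈ traces f, e T - c) =
      (∑ T ∈ traces f \ goodTraces f K, e T - (traces f \ goodTraces f K).card * c) +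
      (∑ T ∈ goodTraces f K, e T - (goodTraces f K).card * c) := by
    rw [mul_sub, mul_inv_cancel_left₀ hN, ← Finset.sum_sdiff (goodTraces_subset f K), hcard']
    ring
  have hbad : ‖∑ T ∈ traces f \ goodTraces f K, e T - (traces f \ goodTraces f K).card * c‖ ≤
      2 * (traces f \ goodTraces f K).card := by
    refine (norm_sub_le _ _).trans ?_
    have h1 : ‖∑ T ∈ traces f \ goodTraces f K, e T‖ ≤ (traces f \ goodTraces f K).card := by
      refine (norm_sum_le _ _).trans ?_
      simp [he1]
    have h2 : ‖((traces f \ goodTraces f K).card : ℂ) * c‖ ≤ (traces f \ goodTraces f K).card := by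
      rw [norm_mul, Complex.norm_natCast]
      exact mul_le_of_le_one_right (by positivity) hc1
    linarith
  have hgood := norm_sum_goodTraces_sub_le f K hf s
  have hgN : ((goodTraces f K).card : ℝ) ≤ (traces f).card := by
    exact_mod_cast Finset.card_le_card (goodTraces_subset f K)
  have hgN' := mul_le_mul_of_nonneg_right hgN (show 0 ≤ |s| * (4 * K + 5) by positivity)
  have hfin := (congrArg norm hsum).le.trans (norm_add_le _ _)
  rw [norm_mul, Complex.norm_natCast] at hfin
  refine le_of_mul_le_mul_left ?_ hN0
  rw [mul_add, ← mul_assoc _ (2 : ℝ), mul_comm _ (2 : ℝ), mul_assoc (2 : ℝ),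
    mul_div_cancel₀ _ hN0.ne']
  linarith

/-! ### Passage to the limit -/

theorem tendsto_cos_pow (t : ℝ) :
    Tendsto (fun f : ℕ => Real.cos (t / √(f : ℝ) / 2) ^ f) atTop (𝓝 (Real.exp (-t ^ 2 / 8))) := by
  -- This is `f` times the error `(5/96) x ^ 4` of `Real.cos_bound` at `x = t / (2√f)`; `1536 = 16 *
  -- 96`.
  have hinv : Tendsto (fun f : ℕ => t ^ 4 * (5 / 1536) * (1 / (f : ℝ))) atTop (𝓝 0) := by
    simpa using (tendsto_one_div_atTop_nhds_zero_nat (𝕜 := ℝ)).const_mul (t ^ 4 * (5 / 1536))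
  have hg : Tendsto (fun f : ℕ => (f : ℝ) * (Real.cos (t / √(f : ℝ) / 2) - 1)) atTop
      (𝓝 (-t ^ 2 / 8)) := by
    rw [tendsto_iff_norm_sub_tendsto_zero]
    refine squeeze_zero' (Eventually.of_forall fun _ => norm_nonneg _) ?_ hinv
    obtain ⟨N, hN⟩ := exists_nat_ge (t ^ 2)
    filter_upwards [eventually_ge_atTop N, eventually_gt_atTop 0] with f hf hf0
    have hf0' : (0 : ℝ) < f := by exact_mod_cast hf0
    have hfN : (t ^ 2 : ℝ) ≤ f := hN.trans (by exact_mod_cast hf)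
    have hsq : √(f : ℝ) ^ 2 = f := Real.sq_sqrt hf0'.le
    have hx2 : (t / √(f : ℝ) / 2) ^ 2 = t ^ 2 / (4 * f) := by
      rw [div_pow, div_pow, hsq]
      field_simp
      norm_num
    have hx1 : |t / √(f : ℝ) / 2| ≤ 1 := by
      rw [← sq_le_one_iff_abs_le_one, hx2, div_le_one (by positivity)]
      linarith
    have hb := Real.cos_bound hx1
    have hx4 : |t / √(f : ℝ) / 2| ^ 4 = t ^ 4 / (16 * f ^ 2) := by
      rw [show 4 = 2 * 2 by norm_num, pow_mul, sq_abs, hx2]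
      field_simp
      ring
    rw [hx4, hx2] at hb
    have heq : (f : ℝ) * (Real.cos (t / √(f : ℝ) / 2) - 1) - -t ^ 2 / 8 =
        f * (Real.cos (t / √(f : ℝ) / 2) - (1 - t ^ 2 / (4 * f) / 2)) := by
      field_simp
      ring
    rw [heq, norm_mul, Real.norm_of_nonneg hf0'.le, Real.norm_eq_abs]
    refine (mul_le_mul_of_nonneg_left hb hf0'.le).trans_eq ?_
    field_simp
    ring
  simpa using Real.tendsto_one_add_pow_exp_of_tendsto hg

/-- A cut-off that tends to infinity and is negligible compared with `√f`. -/
def cutoff (f : ℕ) : ℕ := f.sqrt.sqrt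

theorem tendsto_cutoff : Tendsto cutoff atTop atTop := by
  refine tendsto_atTop.2 fun b => ?_
  filter_upwards [eventually_ge_atTop (b * b * (b * b))] with f hf
  exact Nat.le_sqrt.2 (Nat.le_sqrt.2 hf)

theorem tendsto_cutoff_div_sqrt :
    Tendsto (fun f : ℕ => (4 * (cutoff f : ℝ) + 5) / √(f : ℝ)) atTop (𝓝 0) := by
  have hsqrt : Tendsto (fun f : ℕ => √(√(f : ℝ))) atTop atTop :=
    Real.tendsto_sqrt_atTop.comp (Real.tendsto_sqrt_atTop.comp tendsto_natCast_atTop_atTop)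
  have h9 : Tendsto (fun f : ℕ => 9 * (√(√(f : ℝ)))⁻¹) atTop (𝓝 0) := by
    simpa using (tendsto_inv_atTop_zero.comp hsqrt).const_mul 9
  refine squeeze_zero' (Eventually.of_forall fun _ => by positivity) ?_ h9
  filter_upwards [eventually_gt_atTop 0] with f hf
  have hf1 : (1 : ℝ) ≤ f := by exact_mod_cast hf
  have h1 : (1 : ℝ) ≤ √(√(f : ℝ)) := by
    rw [Real.one_le_sqrt, Real.one_le_sqrt]
    exact hf1
  have h2 : (cutoff f : ℝ) ≤ √(√(f : ℝ)) := by
    refine Real.nat_sqrt_le_real_sqrt.trans (Real.sqrt_le_sqrt ?_)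
    exact Real.nat_sqrt_le_real_sqrt
  have h3 : √(f : ℝ) = √(√(f : ℝ)) * √(√(f : ℝ)) := (Real.mul_self_sqrt (Real.sqrt_nonneg _)).symm
  calc (4 * (cutoff f : ℝ) + 5) / √(f : ℝ) ≤ 9 * √(√(f : ℝ)) / √(f : ℝ) := by
        gcongr
        linarith
    _ = 9 * √(√(f : ℝ)) / (√(√(f : ℝ)) * √(√(f : ℝ))) := by rw [← h3]
    _ = 9 * (√(√(f : ℝ)))⁻¹ := by
        have : √(√(f : ℝ)) ≠ 0 := by positivity
        field_simp

theorem tendsto_card_freeWindow_div :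
    Tendsto (fun f : ℕ => ((freeWindow f (cutoff f)).card : ℝ) / f) atTop (𝓝 (1 / 2)) := by
  rw [tendsto_iff_norm_sub_tendsto_zero]
  refine squeeze_zero' (Eventually.of_forall fun _ => norm_nonneg _) ?_ tendsto_cutoff_div_sqrt
  filter_upwards [eventually_gt_atTop 0] with f hf
  have hf0 : (0 : ℝ) < f := by exact_mod_cast hf
  have hf1 : (1 : ℝ) ≤ f := by exact_mod_cast hf
  have h := card_freeWindow f (cutoff f)
  have h1 : f ≤ 2 * (freeWindow f (cutoff f)).card + 6 * cutoff f + 8 := by omega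
  have h2 : 2 * (freeWindow f (cutoff f)).card ≤ f := by omega
  have h1' : (f : ℝ) ≤ 2 * (freeWindow f (cutoff f)).card + 6 * cutoff f + 8 := by exact_mod_cast h1
  have h2' : 2 * ((freeWindow f (cutoff f)).card : ℝ) ≤ f := by exact_mod_cast h2
  have h3 : √(f : ℝ) ≤ f := by
    rw [Real.sqrt_le_left hf0.le]
    nlinarith
  refine le_trans ?_ (div_le_div_of_nonneg_left (by positivity) (Real.sqrt_pos.2 hf0) h3)
  rw [Real.norm_eq_abs, abs_sub_comm, abs_of_nonneg, le_div_iff₀ hf0, sub_mul,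
    div_mul_cancel₀ _ hf0.ne']
  · have : (0 : ℝ) ≤ cutoff f := by positivity
    linarith
  · rw [sub_nonneg, div_le_iff₀ hf0]
    linarith

/-- The power `cos ^ w` is `(cos ^ f) ^ (w/f)` with `w/f → 1/2`; the real power needs the cosine
positive, which holds eventually. -/
theorem tendsto_cos_pow_card_freeWindow (t : ℝ) :
    Tendsto (fun f : ℕ => Real.cos (t / √(f : ℝ) / 2) ^ (freeWindow f (cutoff f)).card) atTop
      (𝓝 (Real.exp (-t ^ 2 / 16))) := by
  have h := (tendsto_cos_pow t).rpow tendsto_card_freeWindow_div (Or.inl (Real.exp_pos _).ne')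
  rw [← Real.exp_mul, show -t ^ 2 / 8 * (1 / 2) = -t ^ 2 / 16 by ring] at h
  refine h.congr' ?_
  have hsmall : Tendsto (fun f : ℕ => t / √(f : ℝ) / 2) atTop (𝓝 0) := by
    have : Tendsto (fun f : ℕ => √(f : ℝ)) atTop atTop :=
      Real.tendsto_sqrt_atTop.comp tendsto_natCast_atTop_atTop
    simpa using (this.const_div_atTop t).div_const 2
  have hpos : ∀ᶠ f : ℕ in atTop, 0 < Real.cos (t / √(f : ℝ) / 2) := by
    have := (Real.continuous_cos.tendsto 0).comp hsmall
    rw [Real.cos_zero] at this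
    exact this.eventually (lt_mem_nhds one_pos)
  filter_upwards [hpos, eventually_gt_atTop 0] with f hf hf0
  have hf0' : (f : ℝ) ≠ 0 := by exact_mod_cast hf0.ne'
  rw [← Real.rpow_natCast, ← Real.rpow_mul hf.le, mul_div_cancel₀ _ hf0', Real.rpow_natCast]

theorem tendsto_card_sdiff_goodTraces_div :
    Tendsto (fun f : ℕ => ((traces f \ goodTraces f (cutoff f)).card : ℝ) / (traces f).card) atTop
      (𝓝 0) := by
  have hn : Tendsto (fun f : ℕ => (f - 1) / 2) atTop atTop :=
    tendsto_atTop.2 fun b => by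
      filter_upwards [eventually_ge_atTop (2 * b + 1)] with f hf
      omega
  have h1 := ((tendsto_self_mul_const_pow_of_lt_one (r := 197 / 200) (by norm_num)
    (by norm_num)).comp hn).const_mul 2
  have h2 := ((tendsto_pow_atTop_nhds_zero_of_lt_one (r := (35 / 36 : ℝ)) (by norm_num)
    (by norm_num)).comp tendsto_cutoff).const_mul 36
  have h3 := h1.add h2
  rw [mul_zero, mul_zero, add_zero] at h3
  refine squeeze_zero' (Eventually.of_forall fun _ => by positivity) ?_ h3
  filter_upwards [eventually_gt_atTop 0] with f hf
  exact card_sdiff_goodTraces_div_le f (cutoff f) hf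

theorem tendsto_inv_card_mul_sum (t : ℝ) :
    Tendsto (fun f : ℕ => ((traces f).card : ℂ)⁻¹ * ∑ T ∈ traces f,
        Complex.exp (Complex.I * ((t / √(f : ℝ) * ((f : ℝ) / 4 - T.card) : ℝ) : ℂ))) atTop
      (𝓝 ((Real.exp (-t ^ 2 / 16) : ℝ) : ℂ)) := by
  have hcos := (Complex.continuous_ofReal.tendsto _).comp (tendsto_cos_pow_card_freeWindow t)
  have herr : Tendsto (fun f : ℕ =>
      2 * (((traces f \ goodTraces f (cutoff f)).card : ℝ) / (traces f).card) +
        |t / √(f : ℝ)| * (4 * cutoff f + 5)) atTop (𝓝 0) := by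
    have h1 := tendsto_card_sdiff_goodTraces_div.const_mul 2
    have h2 := tendsto_cutoff_div_sqrt.const_mul |t|
    have h3 := h1.add h2
    rw [mul_zero, mul_zero, add_zero] at h3
    refine h3.congr fun f => ?_
    rw [abs_div, abs_of_nonneg (Real.sqrt_nonneg _)]
    ring
  have hdiff := squeeze_zero_norm' (by
    filter_upwards [eventually_gt_atTop 0] with f hf
    exact norm_inv_card_mul_sum_sub_le f (cutoff f) hf (t / √(f : ℝ))) herr
  have h := hdiff.add hcos
  rw [zero_add] at h
  refine h.congr fun f => ?_
  simp

end NumericalSemigroup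

/-- For a uniformly random numerical semigroup `Λ` with Frobenius number `f`, the normalized genus
`(g(Λ) - 3f/4) / √f` converges in distribution, as `f → ∞`, to the centred normal law with
variance `1/8`. -/
theorem mainTheorem10 :
    TendstoInDistribution
      (fun (f : ℕ+) (Λ : NumericalSemigroup) =>
        (1 / √((f : ℕ) : ℝ)) * ((Λ.genus : ℝ) - 3 * ((f : ℕ) : ℝ) / 4))
      atTop (id : ℝ → ℝ) NumericalSemigroup.uniformLaw (gaussianReal 0 (1 / 8 : ℝ≥0)) where
  forall_aemeasurable _ := Measurable.aemeasurable (by fun_prop)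
  aemeasurable_limit := aemeasurable_id
  tendsto := by
    let law : ℕ+ → ProbabilityMeasure ℝ := fun f =>
      ⟨(NumericalSemigroup.uniformLaw f).map
        (fun Λ : NumericalSemigroup => (1 / √((f : ℕ) : ℝ)) *
          ((Λ.genus : ℝ) - 3 * ((f : ℕ) : ℝ) / 4)),
        Measure.isProbabilityMeasure_map (Measurable.aemeasurable (by fun_prop))⟩
    let limitLaw : ProbabilityMeasure ℝ :=
      ⟨(gaussianReal 0 (1 / 8 : ℝ≥0)).map id, Measure.isProbabilityMeasure_map aemeasurable_id⟩
    change Tendsto law atTop (nhds limitLaw)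
    -- The continuity theorem is applied along `ℕ`, with `f = k + 1`; the order isomorphism between
    -- `ℕ+` and `ℕ` then transports the limit back.
    have hval : Tendsto (fun k : ℕ => (k.succPNat : ℕ)) atTop atTop := tendsto_add_atTop_nat 1
    have hseq : Tendsto (fun k : ℕ => law k.succPNat) atTop (nhds limitLaw) := by
      refine ProbabilityMeasure.tendsto_iff_tendsto_charFun.2 fun t => ?_
      simp only [law, limitLaw, ProbabilityMeasure.coe_mk, Measure.map_id,
        NumericalSemigroup.charFun_map_uniformLaw, charFun_gaussianReal]
      have h := (NumericalSemigroup.tendsto_inv_card_mul_sum t).comp hval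
      convert h using 2
      · rfl
      · rw [Complex.ofReal_exp]
        congr 1
        push_cast
        ring
    refine (hseq.comp OrderIso.pnatIsoNat.tendsto_atTop).congr fun f => congrArg law ?_
    exact OrderIso.pnatIsoNat.symm_apply_apply f
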